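/- **Theorem (Strong Feller).** Let $M$ be a $d$-dimensional real-analytic manifold (Hausdorff, second countable, without boundary), and let $\mathcal F=\{Y_1,Y_2,Y_3\}$ be complete real-analytic vector fields on $M$ with flows $\psi^{(1)}_t,\psi^{(2)}_t,\psi^{(3)}_t$. Let $h>0$ and let $\underline\tau=(\tau_1,\tau_2,\dots)$ be independent exponential random variables with mean $h$. The random splitting chain is defined by $\Psi^0_{\underline\tau}=I$ and $$\Psi^m_{\underline\tau}=\psi^{(3)}_{\tau_{3m}}\circ\psi^{(2)}_{\tau_{3m-1}}\circ\psi^{(1)}_{\tau_{3m-2}}\circ\Psi^{m-1}_{\underline\tau},\qquad m\ge 1.$$ Let $Q(x,D)=\mathbb P(\Psi^1_{\underline\tau}(x)\in D)$ be its transition kernel, acting on bounded measurable functions by $Qg(x)=\int_M g(y)\,Q(x,dy)$, with iterates $Q^m$. Let $\mathrm{Lie}(\mathcal F)$ be the smallest linear space of vector fields that contains $\mathcal F$ and is closed under Lie brackets, and let $\mathrm{Lie}_x(\mathcal F)=\{V(x):V\in\mathrm{Lie}(\mathcal F)\}\subset T_xM$. Assume that $\mathrm{Lie}_{x_0}(\mathcal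 F)=T_{x_0}M$ for some $x_0\in M$. Then there exist an integer $m\ge 1$ and an open neighborhood $U$ of $x_0$ such that $Q^m$ is strong Feller on $U$, that is, for every bounded measurable function $g:M\to\mathbb R$ the function $Q^mg$ is continuous on $U$. -/

import Mathlib

open MeasureTheory ProbabilityTheory
open scoped Manifold ContDiff Topology

/-- A vector field on `M` (no regularity), as a section of the tangent bundle. -/
abbrev VectorFieldOn (d : ℕ) (M : Type*) [TopologicalSpace M]
    [ChartedSpace (EuclideanSpace ℝ (Fin d)) M] :=
  (x : M) → TangentSpace (𝓡 d) x

/-- A vector field is analytic if it is an analytic section of the tangent bundle. -/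
def IsAnalyticVectorField {d : ℕ} {M : Type*} [TopologicalSpace M]
    [ChartedSpace (EuclideanSpace ℝ (Fin d)) M] [IsManifold (𝓡 d) ω M]
    (V : VectorFieldOn d M) : Prop :=
  haveI : IsManifold (𝓡 d) 1 M := IsManifold.of_le (n := ω) le_top
  ContMDiff (𝓡 d) (𝓡 d).tangent ω
    (fun x : M ↦ (⟨x, V x⟩ : TangentBundle (𝓡 d) M))

/-- A vector field is complete if through every point there is an integral curve defined for
all times. -/
def IsCompleteVectorField {d : ℕ} {M : Type*} [TopologicalSpace M]
    [ChartedSpace (EuclideanSpace ℝ (Fin d)) M]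
    (V : VectorFieldOn d M) : Prop :=
  ∀ x : M, ∃ γ : ℝ → M, γ 0 = x ∧ IsMIntegralCurve (I := 𝓡 d) γ V

open Classical in
/-- The flow of a vector field `V`: the map `t ↦ vectorFlow V t x` is the integral curve of `V`
that starts at `x` (it exists if `V` is complete, and is then unique for a `C^1` field on a
Hausdorff manifold). The value `x` is a default where there is no global integral curve. -/
noncomputable def vectorFlow {d : ℕ} {M : Type*} [TopologicalSpace M]
    [ChartedSpace (EuclideanSpace ℝ (Fin d)) M]
    (V : VectorFieldOn d M) (t : ℝ) (x : M) : M :=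
  if hx : ∃ γ : ℝ → M, γ 0 = x ∧ IsMIntegralCurve (I := 𝓡 d) γ V then hx.choose t else x

/-- `Lie(F)` for a finite family `F` of vector fields: the smallest linear space of vector fields
that contains the family and is closed under Lie brackets. -/
noncomputable def lieHull {d : ℕ} {M : Type*} [TopologicalSpace M]
    [ChartedSpace (EuclideanSpace ℝ (Fin d)) M]
    (Y : Fin 3 → VectorFieldOn d M) : Submodule ℝ (VectorFieldOn d M) :=
  sInf {S | (∀ i, Y i ∈ S) ∧
    ∀ V ∈ S, ∀ W ∈ S, VectorField.mlieBracket (𝓡 d) V W ∈ S}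

/-- `Lie_x(F)`: the subspace of the tangent space at `x` formed by the values at `x` of the
vector fields in `Lie(F)`. -/
noncomputable def lieHullAt {d : ℕ} {M : Type*} [TopologicalSpace M]
    [ChartedSpace (EuclideanSpace ℝ (Fin d)) M]
    (Y : Fin 3 → VectorFieldOn d M) (x : M) : Submodule ℝ (TangentSpace (𝓡 d) x) :=
  (lieHull Y).map (LinearMap.proj x)

/-- The splitting `Ψ^m` for a deterministic sequence of times `t`: here `t n` is the time that is
usually written `t_{n+1}`, and `Y 0`, `Y 1`, `Y 2` are the three vector fields, which act in this
order in each step. -/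
noncomputable def splitting {d : ℕ} {M : Type*} [TopologicalSpace M]
    [ChartedSpace (EuclideanSpace ℝ (Fin d)) M]
    (Y : Fin 3 → VectorFieldOn d M) (t : ℕ → ℝ) : ℕ → M → M
  | 0, x => x
  | m + 1, x =>
      vectorFlow (Y 2) (t (3 * m + 2)) (vectorFlow (Y 1) (t (3 * m + 1))
        (vectorFlow (Y 0) (t (3 * m)) (splitting Y t m x)))

/-- The transition kernel `Q(x, D) = P(Ψ_τ(x) ∈ D)` of the random splitting chain with random
times `τ`. -/
noncomputable def splittingKernel {d : ℕ} {M : Type*} [TopologicalSpace M]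
    [ChartedSpace (EuclideanSpace ℝ (Fin d)) M] [MeasurableSpace M]
    {Ω : Type*} [MeasurableSpace Ω] (P : Measure Ω)
    (Y : Fin 3 → VectorFieldOn d M) (τ : ℕ → Ω → ℝ) (x : M) : Measure M :=
  P.map (fun o ↦ splitting Y (fun n ↦ τ n o) 1 x)

/-- The action `(κ g)(x) = ∫ g(y) κ(x, dy)` of a kernel on functions. -/
noncomputable def kernelOperator {M : Type*} [MeasurableSpace M]
    (κ : M → Measure M) (g : M → ℝ) (x : M) : ℝ :=
  ∫ y, g y ∂(κ x)

/-- The operator `T` on functions is strong Feller on `U`: for every bounded measurable `g` on the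
whole space, `T g` is continuous on `U`. -/
def StrongFellerOn {M : Type*} [TopologicalSpace M] [MeasurableSpace M]
    (T : (M → ℝ) → M → ℝ) (U : Set M) : Prop :=
  ∀ g : M → ℝ, Measurable g → (∃ C : ℝ, ∀ x, |g x| ≤ C) → ContinuousOn (T g) U

/-! The function `Q^m g` at `x` is the integral of `g(Ψ^m_t(x))` over the law of the `3m` times `t`,
a law with bounded density. Integration over `t` smooths `g` wherever `t ↦ Ψ^m_t(x)` is a
submersion. So two facts suffice: for some `m` this map is a submersion at one `t` when `x = x₀`,
and one such point yields continuity near `x₀`.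

For the first (`exists_surjective_mfderiv_splittingFamily`), let the times be arbitrary reals and
take `m` and `t` of maximal rank among those with `Ψ^m_t(x₀)` close to `x₀`. An extra step with zero
times does not move the point, cannot raise the rank, and puts every `Y_i` into the range of the
derivative. Hence the `Y_i` were already in that range, and likewise at nearby times. The image is
locally an immersed submanifold (`exists_immersion_of_maximal_rank`) to which the `Y_i` are tangent,
and tangency passes to brackets (`lieBracket_mem_range_fderiv`). Thus all of `Lie(F)` is tangent,
and since it spans near `x₀`, the rank is `d`.

For the second (`exists_isOpen_continuousOn_integral`), the same `t` remains a submersion point for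
`x` near `x₀`, and for each such `x` analyticity spreads the property to almost every `t`
(`ae_surjective_mfderiv`). It is therefore harmless that the point found may have zero or negative
times. Near a submersion point, the image of Lebesgue measure has density bounded uniformly in `x`
(`HasStrictFDerivAt.exists_measure_le_mul_image`), so approximating `g` by continuous functions in
`L¹` shows that `g(Ψ^m_t(x))` depends continuously on `x` in `L¹`, locally in `t`. Compact subsets
of the submersion set carry nearly all the mass.

The joint analyticity of the flows (`IsCompleteVectorField.contMDiff_vectorFlow`) comes from the
implicit function theorem applied to Picard's integral equation. -/

/-! ### Analytic superposition operators on spaces of continuous functions. -/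

section AnalyticSuperposition

variable {K E F : Type*} [TopologicalSpace K] [CompactSpace K]
  [NormedAddCommGroup E] [NormedSpace ℝ E] [NormedAddCommGroup F] [NormedSpace ℝ F]

/-- The formal power series on `C(K, E)` obtained by applying a formal power series on `E`
pointwise. -/
noncomputable def FormalMultilinearSeries.pointwise (K : Type*) [TopologicalSpace K]
    [CompactSpace K] (p : FormalMultilinearSeries ℝ E F) :
    FormalMultilinearSeries ℝ C(K, E) C(K, F) := fun n ↦
  MultilinearMap.mkContinuous
    { toFun := fun m ↦
        ⟨fun s ↦ p n (fun i ↦ m i s), (p n).cont.comp (continuous_pi fun i ↦ (m i).continuous)⟩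
      map_update_add' := by
        intro _ m i x y
        ext s
        have key : ∀ z : C(K, E), (fun j ↦ (Function.update m i z) j s) =
            Function.update (fun j ↦ m j s) i (z s) := by
          intro z
          ext j
          rcases eq_or_ne j i with rfl | h <;> simp [*]
        simp [key]
      map_update_smul' := by
        intro _ m i c x
        ext s
        have key : ∀ z : C(K, E), (fun j ↦ (Function.update m i z) j s) =
            Function.update (fun j ↦ m j s) i (z s) := by
          intro z
          ext j
          rcases eq_or_ne j i with rfl | h <;> simp [*]
        simp [key] } ‖p n‖ (by
      intro m
      rw [ContinuousMap.norm_le _ (by positivity)]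
      intro s
      refine ((p n).le_opNorm _).trans ?_
      gcongr with i
      exact (m i).norm_coe_le_norm s)

lemma FormalMultilinearSeries.radius_le_radius_pointwise (p : FormalMultilinearSeries ℝ E F) :
    p.radius ≤ (p.pointwise K).radius :=
  FormalMultilinearSeries.radius_le_of_le fun _ ↦
    MultilinearMap.mkContinuous_norm_le _ (norm_nonneg _) _

/-- The superposition operator of a map that is analytic at `x` is analytic at the constant
function `x`. -/
theorem AnalyticAt.exists_superposition [CompleteSpace F] {V : E → F} {x : E}
    (hV : AnalyticAt ℝ V x) :
    ∃ N : C(K, E) → C(K, F), AnalyticAt ℝ N (ContinuousMap.const K x) ∧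
      ∃ r > 0, ∀ γ : C(K, E), (∀ s, dist (γ s) x < r) → ∀ s, N γ s = V (γ s) := by
  obtain ⟨p, r, hp⟩ := hV
  have hpos : 0 < (p.pointwise K).radius :=
    (hp.r_pos.trans_le hp.r_le).trans_le p.radius_le_radius_pointwise
  have hq := (p.pointwise K).hasFPowerSeriesOnBall hpos
  have hq' := hq.comp_sub (ContinuousMap.const K x)
  rw [zero_add] at hq'
  refine ⟨_, hq'.analyticAt, ?_⟩
  -- A radius strictly inside `r`: the pointwise bounds are used only as `≤ ρ` in the sup norm,
  -- which must still land in the open ball.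
  obtain ⟨ρ, hρ, hρr⟩ := ENNReal.lt_iff_exists_nnreal_btwn.1 hp.r_pos
  refine ⟨ρ, by simpa using hρ, fun γ hγ s ↦ ?_⟩
  have hη : ‖γ - ContinuousMap.const K x‖ ≤ ρ := by
    refine (ContinuousMap.norm_le _ ρ.2).2 fun s ↦ ?_
    simpa [dist_eq_norm] using (hγ s).le
  have hη' : γ - ContinuousMap.const K x ∈ Metric.eball (0 : C(K, E)) (p.pointwise K).radius := by
    rw [Metric.mem_eball, edist_zero_right]
    refine lt_of_le_of_lt ?_ (hρr.trans_le (hp.r_le.trans p.radius_le_radius_pointwise))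
    rw [← ofReal_norm]
    exact ENNReal.ofReal_le_of_le_toReal (by simpa using hη)
  have h1 := (hq.hasSum hη').map (ContinuousMap.evalCLM ℝ s) (ContinuousMap.evalCLM ℝ s).continuous
  have hs : γ s - x ∈ Metric.eball (0 : E) r := by
    rw [Metric.mem_eball, edist_zero_right]
    refine lt_of_le_of_lt ?_ hρr
    rw [← ofReal_norm, ← dist_eq_norm]
    exact ENNReal.ofReal_le_of_le_toReal (by simpa using (hγ s).le)
  have h2 := hp.hasSum hs
  rw [add_sub_cancel] at h2
  have h3 := h1.unique h2
  simpa using h3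

end AnalyticSuperposition

/-! ### Analytic local flows in a Banach space. -/

section LocalFlow

variable {E : Type*} [NormedAddCommGroup E] [NormedSpace ℝ E]

/-- The primitive that vanishes at `0`, as a continuous linear map on `C([-2, 2], E)`. -/
noncomputable def primitiveCLM (E : Type*) [NormedAddCommGroup E] [NormedSpace ℝ E] :
    C(Set.Icc (-2 : ℝ) 2, E) →L[ℝ] C(Set.Icc (-2 : ℝ) 2, E) :=
  LinearMap.mkContinuous
    { toFun := fun γ ↦ ⟨fun s ↦ ∫ u in (0 : ℝ)..s, Set.IccExtend (by norm_num) γ u, by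
        refine (intervalIntegral.continuous_primitive (fun a b ↦ ?_) 0).comp
          continuous_subtype_val
        exact (γ.continuous.Icc_extend' (h := by norm_num)).intervalIntegrable _ _⟩
      map_add' := by
        intro γ η
        ext s
        simp only [ContinuousMap.coe_mk, ContinuousMap.add_apply]
        rw [← intervalIntegral.integral_add]
        · rfl
        · exact (γ.continuous.Icc_extend' (h := by norm_num)).intervalIntegrable _ _
        · exact (η.continuous.Icc_extend' (h := by norm_num)).intervalIntegrable _ _
      map_smul' := by
        intro c γ
        ext s
        simp only [ContinuousMap.coe_mk, ContinuousMap.smul_apply, RingHom.id_apply]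
        rw [← intervalIntegral.integral_smul]
        rfl } 2 (by
    intro γ
    rw [ContinuousMap.norm_le _ (by positivity)]
    intro s
    have h := intervalIntegral.norm_integral_le_of_norm_le_const (a := 0) (b := (s : ℝ))
      (f := Set.IccExtend (by norm_num : (-2 : ℝ) ≤ 2) γ) (C := ‖γ‖)
      (fun u _ ↦ γ.norm_coe_le_norm _)
    refine h.trans ?_
    rw [mul_comm]
    gcongr
    rw [sub_zero, abs_le]
    exact s.2)

/-- Local flows of analytic vector fields are analytic. -/
theorem AnalyticAt.exists_local_flow [CompleteSpace E] {V : E → E} {x : E} (hV : AnalyticAt ℝ V x)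
    {U : Set E} (hU : U ∈ 𝓝 x) :
    ∃ φ : ℝ × E → E, ContDiffAt ℝ ω φ (0, x) ∧ ∀ᶠ q in 𝓝 ((0 : ℝ), x),
      ∃ c : ℝ → E, c 0 = q.2 ∧ c 1 = φ q ∧
        ∀ s ∈ Set.Ioo (-2 : ℝ) 2, c s ∈ U ∧ HasDerivAt c (q.1 • V (c s)) s := by
  set K := Set.Icc (-2 : ℝ) 2 with hK
  obtain ⟨N, hN, r, hr, hNV⟩ := hV.exists_superposition (K := K)
  let cst : E →L[ℝ] C(K, E) := ContinuousLinearMap.const ℝ K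
  -- Near the constant curve, zeros of `Φ` solve the Picard equation `γ(s) = y + τ ∫₀ˢ V(γ)`. The
  -- flow time `τ` is a scalar parameter, so the flow at time `τ` is read off at the fixed point `s
  -- = 1`, which is interior to the interval `[-2, 2]`.
  let Φ : (ℝ × E) × C(K, E) → C(K, E) := fun p ↦
    p.2 - cst p.1.2 - p.1.1 • primitiveCLM E (N p.2)
  have hcx : ContinuousMap.const K x = cst x := rfl
  rw [hcx] at hN
  have hN' : ContDiffAt ℝ ω N (cst x) := hN.contDiffAt
  have hΦ : ContDiffAt ℝ ω Φ ((0, x), cst x) := by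
    have h0 : ContDiffAt ℝ ω (fun p : (ℝ × E) × C(K, E) ↦ N p.2) ((0, x), cst x) :=
      ContDiffAt.comp (g := N) (f := Prod.snd) ((0, x), cst x) hN' contDiffAt_snd
    have h1 : ContDiffAt ℝ ω (fun p : (ℝ × E) × C(K, E) ↦ primitiveCLM E (N p.2))
        ((0, x), cst x) := (primitiveCLM E).contDiff.contDiffAt.comp _ h0
    have h2 : ContDiffAt ℝ ω (fun p : (ℝ × E) × C(K, E) ↦ cst p.1.2) ((0, x), cst x) :=
      cst.contDiff.contDiffAt.comp _ (contDiffAt_fst.snd)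
    exact (contDiffAt_snd.sub h2).sub ((contDiffAt_fst.fst).smul h1)
  have hω : (ω : WithTop ℕ∞) ≠ 0 := by simp
  have hΦ0 : Φ ((0, x), cst x) = 0 := by simp [Φ]
  -- At `τ = 0` the integral term vanishes, so the partial derivative in the curve is the identity.
  have hinv : (fderiv ℝ Φ ((0, x), cst x) ∘L .inr ℝ (ℝ × E) C(K, E)).IsInvertible := by
    have h1 : HasFDerivAt (fun γ : C(K, E) ↦ Φ ((0, x), γ))
        (fderiv ℝ Φ ((0, x), cst x) ∘L .inr ℝ (ℝ × E) C(K, E)) (cst x) :=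
      (hΦ.differentiableAt hω).hasFDerivAt.comp (cst x) (hasFDerivAt_prodMk_right (0, x) (cst x))
    have h2 : HasFDerivAt (fun γ : C(K, E) ↦ Φ ((0, x), γ)) (.id ℝ C(K, E)) (cst x) := by
      have : (fun γ : C(K, E) ↦ Φ ((0, x), γ)) = fun γ ↦ γ - cst x := by
        ext γ; simp [Φ]
      rw [this]
      exact (hasFDerivAt_id _).sub_const _
    rw [h1.unique h2]
    exact ContinuousLinearMap.isInvertible_equiv (f := ContinuousLinearEquiv.refl ℝ _)
  let ψ := hΦ.implicitFunction hω hinv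
  have hψ : ContDiffAt ℝ ω ψ (0, x) := hΦ.contDiffAt_implicitFunction hω hinv
  have hψ0 : ψ (0, x) = cst x := hΦ.implicitFunction_apply_self hω hinv
  have hψe : ∀ᶠ q in 𝓝 ((0 : ℝ), x), Φ (q, ψ q) = 0 := by
    rw [← hΦ0]
    exact hΦ.eventually_apply_implicitFunction hω hinv
  obtain ⟨ρ, hρ, hρU⟩ := Metric.mem_nhds_iff.1 hU
  have hclose : ∀ᶠ q in 𝓝 ((0 : ℝ), x), ‖ψ q - cst x‖ < min r ρ := by
    have h1 : Filter.Tendsto (fun q ↦ ‖ψ q - cst x‖) (𝓝 ((0 : ℝ), x)) (𝓝 ‖ψ (0, x) - cst x‖) :=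
      (hψ.continuousAt.sub continuousAt_const).norm
    rw [hψ0, sub_self, norm_zero] at h1
    exact h1.eventually (gt_mem_nhds (lt_min hr hρ))
  have one_mem : (1 : ℝ) ∈ K := by simp [hK]; norm_num
  refine ⟨fun q ↦ ψ q ⟨1, one_mem⟩, ?_, ?_⟩
  · exact (ContinuousMap.evalCLM ℝ (⟨1, one_mem⟩ : K)).contDiff.contDiffAt.comp _ hψ
  filter_upwards [hψe, hclose] with q hq hcl
  have hd : ∀ s, dist (ψ q s) x < min r ρ := fun s ↦ by
    rw [dist_eq_norm]
    exact ((ψ q - cst x).norm_coe_le_norm s).trans_lt hcl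
  have hNs : ∀ s, N (ψ q) s = V (ψ q s) := hNV _ fun s ↦ (hd s).trans_le (min_le_left _ _)
  have hfix : ∀ s : K, ψ q s = q.2 + q.1 • ∫ u in (0 : ℝ)..s,
      Set.IccExtend (by norm_num : (-2 : ℝ) ≤ 2) (N (ψ q)) u := by
    intro s
    have h := congrArg (fun γ : C(K, E) ↦ γ s) hq
    simp only [Φ, ContinuousMap.sub_apply, ContinuousMap.zero_apply, sub_sub] at h
    exact sub_eq_zero.1 h
  have hcont : Continuous (Set.IccExtend (by norm_num : (-2 : ℝ) ≤ 2) (N (ψ q))) :=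
    (N (ψ q)).continuous.Icc_extend'
  refine ⟨fun s ↦ q.2 + q.1 • ∫ u in (0 : ℝ)..s,
    Set.IccExtend (by norm_num : (-2 : ℝ) ≤ 2) (N (ψ q)) u, by simp, (hfix ⟨1, one_mem⟩).symm, ?_⟩
  intro s hs
  have hsK : s ∈ K := ⟨hs.1.le, hs.2.le⟩
  have hval := hfix ⟨s, hsK⟩
  beta_reduce
  rw [← hval]
  refine ⟨hρU ((hd _).trans_le (min_le_right _ _)), ?_⟩
  have hder : HasDerivAt (fun s ↦ ∫ u in (0 : ℝ)..s,
      Set.IccExtend (by norm_num : (-2 : ℝ) ≤ 2) (N (ψ q)) u) (V (ψ q ⟨s, hsK⟩)) s := by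
    rw [← hNs, ← Set.IccExtend_of_mem (by norm_num : (-2 : ℝ) ≤ 2) (N (ψ q)) hsK]
    exact intervalIntegral.integral_hasDerivAt_right (hcont.intervalIntegrable _ _)
      hcont.stronglyMeasurable.stronglyMeasurableAtFilter hcont.continuousAt
  exact (hder.const_smul q.1).const_add q.2

end LocalFlow

/-! ### Vector fields and brackets in coordinates. -/

section ChartField

variable {d : ℕ} {M : Type*} [TopologicalSpace M] [ChartedSpace (EuclideanSpace ℝ (Fin d)) M]

/-- The coordinate expression of a vector field in the chart at `x₀`. -/
noncomputable def chartField (x₀ : M) (V : VectorFieldOn d M) :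
    EuclideanSpace ℝ (Fin d) → EuclideanSpace ℝ (Fin d) :=
  VectorField.mpullback 𝓘(ℝ, EuclideanSpace ℝ (Fin d)) (𝓡 d) (extChartAt (𝓡 d) x₀).symm V

lemma chartField_add (x₀ : M) (V W : VectorFieldOn d M) :
    chartField x₀ (V + W) = chartField x₀ V + chartField x₀ W :=
  VectorField.mpullback_add

lemma chartField_smul (x₀ : M) (c : ℝ) (V : VectorFieldOn d M) :
    chartField x₀ (c • V) = c • chartField x₀ V :=
  VectorField.mpullback_const_smul

lemma chartField_zero (x₀ : M) : chartField x₀ (0 : VectorFieldOn d M) = 0 := by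
  simpa using chartField_smul x₀ (0 : ℝ) (0 : VectorFieldOn d M)

section

variable [IsManifold (𝓡 d) 1 M] {x₀ : M} {y : EuclideanSpace ℝ (Fin d)}

lemma isInvertible_mfderiv_extChartAt_symm (hy : y ∈ (extChartAt (𝓡 d) x₀).target) :
    (mfderiv 𝓘(ℝ, EuclideanSpace ℝ (Fin d)) (𝓡 d) (extChartAt (𝓡 d) x₀).symm y).IsInvertible := by
  have h := isInvertible_mfderivWithin_extChartAt_symm (I := 𝓡 d) hy
  rwa [ModelWithCorners.range_eq_univ, mfderivWithin_univ] at h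

lemma mfderiv_extChartAt_symm_chartField (hy : y ∈ (extChartAt (𝓡 d) x₀).target)
    (V : VectorFieldOn d M) :
    mfderiv 𝓘(ℝ, EuclideanSpace ℝ (Fin d)) (𝓡 d) (extChartAt (𝓡 d) x₀).symm y
      (chartField x₀ V y) = V ((extChartAt (𝓡 d) x₀).symm y) :=
  (isInvertible_mfderiv_extChartAt_symm hy).self_apply_inverse _

end

lemma contMDiffAt_extChartAt_symm_target {n : WithTop ℕ∞} [IsManifold (𝓡 d) n M] {x₀ : M}
    {y : EuclideanSpace ℝ (Fin d)} (hy : y ∈ (extChartAt (𝓡 d) x₀).target) :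
    ContMDiffAt 𝓘(ℝ, EuclideanSpace ℝ (Fin d)) (𝓡 d) n (extChartAt (𝓡 d) x₀).symm y :=
  (contMDiffOn_extChartAt_symm x₀).contMDiffAt ((isOpen_extChartAt_target x₀).mem_nhds hy)

variable [IsManifold (𝓡 d) ω M]

instance isManifold_one_of_omega : IsManifold (𝓡 d) 1 M := IsManifold.of_le (n := ω) le_top

lemma contDiffAt_chartField {n : WithTop ℕ∞} {x₀ : M} {y : EuclideanSpace ℝ (Fin d)}
    (hy : y ∈ (extChartAt (𝓡 d) x₀).target) {V : VectorFieldOn d M}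
    (hV : ContMDiffAt (𝓡 d) (𝓡 d).tangent n
      (fun x : M ↦ (⟨x, V x⟩ : TangentBundle (𝓡 d) M)) ((extChartAt (𝓡 d) x₀).symm y)) :
    ContDiffAt ℝ n (chartField x₀ V) y :=
  contMDiffAt_vectorSpace_iff_contDiffAt.1
    (ContMDiffAt.mpullback_vectorField_preimage (n := ω) hV (contMDiffAt_extChartAt_symm_target hy)
      (isInvertible_mfderiv_extChartAt_symm hy) le_top)

lemma chartField_mlieBracket {x₀ : M} {y : EuclideanSpace ℝ (Fin d)}
    (hy : y ∈ (extChartAt (𝓡 d) x₀).target) {V W : VectorFieldOn d M}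
    (hV : MDifferentiableAt (𝓡 d) (𝓡 d).tangent
      (fun x : M ↦ (⟨x, V x⟩ : TangentBundle (𝓡 d) M)) ((extChartAt (𝓡 d) x₀).symm y))
    (hW : MDifferentiableAt (𝓡 d) (𝓡 d).tangent
      (fun x : M ↦ (⟨x, W x⟩ : TangentBundle (𝓡 d) M)) ((extChartAt (𝓡 d) x₀).symm y)) :
    chartField x₀ (VectorField.mlieBracket (𝓡 d) V W) y =
      VectorField.lieBracket ℝ (chartField x₀ V) (chartField x₀ W) y := by
  have : IsManifold (𝓡 d) (minSmoothness ℝ 2) M := IsManifold.of_le (n := ω) le_top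
  have : IsManifold (𝓡 d) (minSmoothness ℝ 3) M := IsManifold.of_le (n := ω) le_top
  have h := VectorField.mpullback_mlieBracket (n := ω) (I := 𝓘(ℝ, EuclideanSpace ℝ (Fin d)))
    (I' := 𝓡 d) hV hW (contMDiffAt_extChartAt_symm_target hy) le_top
  refine h.trans ?_
  rw [← VectorField.mlieBracketWithin_univ, VectorField.mlieBracketWithin_eq_lieBracketWithin]
  exact congrFun (VectorField.lieBracketWithin_univ (V := chartField x₀ V)) y

end ChartField

/-! ### Joint analyticity of the flow of a complete analytic field. -/

section Flow

lemma ContinuousLinearMap.comp_toSpanSingleton_smul_eq_smulRight {E F : Type*}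
    [AddCommGroup E] [TopologicalSpace E] [IsTopologicalAddGroup E] [Module ℝ E]
    [ContinuousSMul ℝ E] [AddCommGroup F] [TopologicalSpace F] [IsTopologicalAddGroup F]
    [Module ℝ F] [ContinuousSMul ℝ F] (t : ℝ) {A : E →L[ℝ] F} {v : E} {w : F} (h : A v = w) :
    A ∘L ContinuousLinearMap.toSpanSingleton ℝ (t • v) =
      (1 : ℝ →L[ℝ] ℝ).smulRight (t • w) := by
  ext
  simp [h]

variable {d : ℕ} {M : Type*} [TopologicalSpace M] [ChartedSpace (EuclideanSpace ℝ (Fin d)) M]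
  {V : VectorFieldOn d M}

lemma IsCompleteVectorField.vectorFlow_zero (hc : IsCompleteVectorField V) (x : M) :
    vectorFlow V 0 x = x := by
  rw [vectorFlow, dif_pos (hc x)]
  exact (hc x).choose_spec.1

lemma IsCompleteVectorField.isMIntegralCurve_vectorFlow (hc : IsCompleteVectorField V) (x : M) :
    IsMIntegralCurve (I := 𝓡 d) (fun t ↦ vectorFlow V t x) V := by
  have h : (fun t ↦ vectorFlow V t x) = (hc x).choose := by
    ext t
    rw [vectorFlow, dif_pos (hc x)]
  rw [h]
  exact (hc x).choose_spec.2

variable [IsManifold (𝓡 d) ω M]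

lemma IsAnalyticVectorField.contMDiff_const_smul (hV : IsAnalyticVectorField V) (c : ℝ) :
    ContMDiff (𝓡 d) (𝓡 d).tangent 1 (fun x : M ↦ (⟨x, (c • V) x⟩ : TangentBundle (𝓡 d) M)) := by
  have h : ContMDiff (𝓡 d) (𝓡 d).tangent 1 (fun x : M ↦ (⟨x, V x⟩ : TangentBundle (𝓡 d) M)) :=
    ContMDiff.of_le hV le_top
  exact h.const_smul_section

variable [T2Space M]

/-- By uniqueness of integral curves, a curve built locally in a chart must agree with the flow,
although the latter is defined by choice. -/
lemma IsCompleteVectorField.eqOn_vectorFlow_mul (hc : IsCompleteVectorField V)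
    (hV : IsAnalyticVectorField V) {γ : ℝ → M} {t : ℝ} {a b : ℝ} (h0 : (0 : ℝ) ∈ Set.Ioo a b)
    (hγ : IsMIntegralCurveOn (I := 𝓡 d) γ (t • V) (Set.Ioo a b)) :
    Set.EqOn γ (fun s ↦ vectorFlow V (s * t) (γ 0)) (Set.Ioo a b) := by
  refine isMIntegralCurveOn_Ioo_eqOn_of_contMDiff_boundaryless h0 (hV.contMDiff_const_smul t) hγ
    (((hc.isMIntegralCurve_vectorFlow (γ 0)).comp_mul t).isMIntegralCurveOn _) ?_
  simp [hc.vectorFlow_zero]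

lemma IsCompleteVectorField.vectorFlow_add (hc : IsCompleteVectorField V)
    (hV : IsAnalyticVectorField V) (s t : ℝ) (x : M) :
    vectorFlow V (s + t) x = vectorFlow V s (vectorFlow V t x) := by
  have h1 := (hc.isMIntegralCurve_vectorFlow x).comp_add t
  have h2 := hc.isMIntegralCurve_vectorFlow (vectorFlow V t x)
  have h3 := isMIntegralCurve_Ioo_eq_of_contMDiff_boundaryless (t₀ := 0)
    (ContMDiff.of_le hV le_top) h1 h2 (by simp [hc.vectorFlow_zero])
  exact congrFun h3 s

/-- In the chart at `x₀`, the local flow of the coordinate field is analytic. Its curves, carried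
back to `M`, are integral curves of `t • V`, and by uniqueness their value at parameter `1` is the
flow at time `t`. -/
lemma IsCompleteVectorField.contMDiffAt_vectorFlow_zero (hc : IsCompleteVectorField V)
    (hV : IsAnalyticVectorField V) (x₀ : M) :
    ContMDiffAt (𝓘(ℝ, ℝ).prod (𝓡 d)) (𝓡 d) ω (fun p : ℝ × M ↦ vectorFlow V p.1 p.2) (0, x₀) := by
  set e := extChartAt (𝓡 d) x₀ with he
  have hx : e x₀ ∈ e.target := mem_extChartAt_target x₀
  have hVa : AnalyticAt ℝ (chartField x₀ V) (e x₀) := (contDiffAt_chartField hx (hV _)).analyticAt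
  obtain ⟨φ, hφ, hφc⟩ := hVa.exists_local_flow ((isOpen_extChartAt_target x₀).mem_nhds hx)
  have hmap : ContMDiffAt (𝓘(ℝ, ℝ).prod (𝓡 d)) (𝓘(ℝ, ℝ).prod 𝓘(ℝ, EuclideanSpace ℝ (Fin d))) ω
      (fun p : ℝ × M ↦ (p.1, e p.2)) ((0 : ℝ), x₀) :=
    contMDiffAt_fst.prodMk (contMDiffAt_extChartAt.comp ((0 : ℝ), x₀) contMDiffAt_snd)
  have hval : ∀ᶠ p in 𝓝 ((0 : ℝ), x₀), vectorFlow V p.1 p.2 = e.symm (φ (p.1, e p.2)) := by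
    have h1 := hmap.continuousAt.eventually hφc
    have h2 : ∀ᶠ p in 𝓝 ((0 : ℝ), x₀), p.2 ∈ e.source :=
      continuousAt_snd.eventually (extChartAt_source_mem_nhds x₀)
    filter_upwards [h1, h2] with p ⟨c, hc0, hc1, hcs⟩ hp
    have hγ : IsMIntegralCurveOn (I := 𝓡 d) (fun s ↦ e.symm (c s)) (p.1 • V)
        (Set.Ioo (-2) 2) := by
      intro s hs
      obtain ⟨hsU, hsd⟩ := hcs s hs
      have hd := (contMDiffAt_extChartAt_symm_target (n := ω) hsU).mdifferentiableAt
        (by simp) |>.hasMFDerivAt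
      have h3 := hd.comp s hsd.hasFDerivAt.hasMFDerivAt
      refine HasMFDerivAt.hasMFDerivWithinAt ?_
      have h4 := ContinuousLinearMap.comp_toSpanSingleton_smul_eq_smulRight p.1
        (mfderiv_extChartAt_symm_chartField hsU V)
      exact (congrArg (HasMFDerivAt 𝓘(ℝ, ℝ) (𝓡 d) (e.symm ∘ c) s) h4).mp h3
    have h5 := hc.eqOn_vectorFlow_mul hV (by norm_num) hγ (show (1 : ℝ) ∈ Set.Ioo (-2 : ℝ) 2 by norm_num)
    simp only [hc1, hc0, one_mul, e.left_inv hp] at h5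
    exact h5.symm
  refine ContMDiffAt.congr_of_eventuallyEq ?_ hval
  have hφ0 : φ (0, e x₀) ∈ e.target := by
    obtain ⟨c, -, hc1, hcs⟩ := hφc.self_of_nhds
    rw [← hc1]
    exact (hcs 1 (by norm_num)).1
  have h6 : ContMDiffAt (𝓘(ℝ, ℝ).prod (𝓡 d)) 𝓘(ℝ, EuclideanSpace ℝ (Fin d)) ω
      (fun p : ℝ × M ↦ φ (p.1, e p.2)) ((0 : ℝ), x₀) := by
    refine ContMDiffAt.comp ((0 : ℝ), x₀) (g := φ) ?_ hmap
    rw [← modelWithCornersSelf_prod, chartedSpaceSelf_prod]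
    exact hφ.contMDiffAt
  refine ContMDiffAt.comp ((0 : ℝ), x₀) (g := e.symm) ?_ h6
  exact contMDiffAt_extChartAt_symm_target hφ0

/-- For fixed `x`, the times `t` at which the flow is analytic at `(t, x)` form a clopen set
containing `0`. Indeed `ψ_r = ψ_{r-s} ∘ ψ_s`, and the first factor is analytic for small `r - s`
near a given point of the orbit. The window of times this provides depends only on that point, so it
gives both openness and closedness. -/
theorem IsCompleteVectorField.contMDiff_vectorFlow (hc : IsCompleteVectorField V)
    (hV : IsAnalyticVectorField V) :
    ContMDiff (𝓘(ℝ, ℝ).prod (𝓡 d)) (𝓡 d) ω (fun p : ℝ × M ↦ vectorFlow V p.1 p.2) := by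
  rintro ⟨t, x⟩
  set S := {t : ℝ | ContMDiffAt (𝓘(ℝ, ℝ).prod (𝓡 d)) (𝓡 d) ω
    (fun p : ℝ × M ↦ vectorFlow V p.1 p.2) (t, x)} with hS
  have hstep : ∀ s ∈ S, ∀ r : ℝ, ContMDiffAt (𝓘(ℝ, ℝ).prod (𝓡 d)) (𝓡 d) ω
      (fun p : ℝ × M ↦ vectorFlow V p.1 p.2) (r - s, vectorFlow V s x) → r ∈ S := by
    intro s hs r hr
    have h1 : (fun p : ℝ × M ↦ vectorFlow V p.1 p.2) =
        (fun p : ℝ × M ↦ vectorFlow V p.1 p.2) ∘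
          (fun p : ℝ × M ↦ (p.1 - s, vectorFlow V s p.2)) := by
      ext p
      simp [← hc.vectorFlow_add hV]
    rw [hS, Set.mem_ofPred_eq, h1]
    refine ContMDiffAt.comp (r, x) hr ?_
    refine ContMDiffAt.prodMk (contMDiffAt_fst.sub contMDiffAt_const) ?_
    have h2 : ContMDiffAt (𝓘(ℝ, ℝ).prod (𝓡 d)) (𝓘(ℝ, ℝ).prod (𝓡 d)) ω
      (fun p : ℝ × M ↦ (s, p.2)) (r, x) := contMDiffAt_const.prodMk contMDiffAt_snd
    exact ContMDiffAt.comp (g := fun p : ℝ × M ↦ vectorFlow V p.1 p.2)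
      (f := fun p : ℝ × M ↦ (s, p.2)) (r, x) hs h2
  have hloc : ∀ t₁ : ℝ, ∃ W ∈ 𝓝 t₁, ∀ s ∈ W, ∀ r ∈ W, s ∈ S → r ∈ S := by
    intro t₁
    have h1 := (contMDiffAt_iff_contMDiffAt_nhds (n := ω) (by simp)).1
      (hc.contMDiffAt_vectorFlow_zero hV (vectorFlow V t₁ x))
    rw [nhds_prod_eq, Filter.eventually_prod_iff] at h1
    obtain ⟨p, hp, q, hq, hpq⟩ := h1
    obtain ⟨ε, hε, hεp⟩ := Metric.eventually_nhds_iff.1 hp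
    have h2 := (hc.isMIntegralCurve_vectorFlow x).continuous.continuousAt (x := t₁)
    refine ⟨_, Filter.inter_mem (h2 hq) (Metric.ball_mem_nhds t₁ (half_pos hε)), ?_⟩
    rintro s ⟨hs1, hs2⟩ r ⟨-, hr2⟩ hs
    refine hstep s hs r (hpq (hεp ?_) hs1)
    rw [dist_zero_right, ← dist_eq_norm]
    rw [Metric.mem_ball] at hs2 hr2
    linarith [dist_triangle_right r s t₁]
  have hclopen : IsClopen S := by
    refine ⟨⟨isOpen_iff_mem_nhds.2 fun t₁ ht₁ ↦ ?_⟩, isOpen_iff_mem_nhds.2 fun t₁ ht₁ ↦ ?_⟩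
    · obtain ⟨W, hW, h⟩ := hloc t₁
      filter_upwards [hW] with s hs hsS
      exact ht₁ (h s hs t₁ (mem_of_mem_nhds hW) hsS)
    · obtain ⟨W, hW, h⟩ := hloc t₁
      filter_upwards [hW] with s hs
      exact h t₁ (mem_of_mem_nhds hW) s hs ht₁
  have huniv := hclopen.eq_univ ⟨0, hc.contMDiffAt_vectorFlow_zero hV x⟩
  exact huniv.ge (Set.mem_univ t)

end Flow

/-! ### Null sets along lines, and rank of analytic families of linear maps. -/

section NullSets

/-- A measurable set that meets every line through a given point in a null set is null. -/
theorem MeasureTheory.Measure.measure_eq_zero_of_null_on_lines {E : Type*} [NormedAddCommGroup E]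
    [NormedSpace ℝ E] [FiniteDimensional ℝ E] [MeasurableSpace E] [BorelSpace E] (μ : Measure E)
    [μ.IsAddHaarMeasure] {N : Set E} (hN : MeasurableSet N) (p : E)
    (h : ∀ v : E, volume {s : ℝ | p + s • v ∈ N} = 0) : μ N = 0 := by
  have hmeas : MeasurableSet {q : E × ℝ | ¬ (p + q.2 • q.1 ∈ N)} := by
    have h1 : Measurable fun q : E × ℝ ↦ p + q.2 • q.1 := by fun_prop
    exact (h1 hN).compl
  have h1 : ∀ᵐ v ∂μ, ∀ᵐ s : ℝ, ¬ (p + s • v ∈ N) :=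
    Filter.Eventually.of_forall fun v ↦ by
      rw [ae_iff]
      simpa using h v
  -- By Fubini, some `s ≠ 0` has a null slice `{v | p + s • v ∈ N}`, which is the preimage of `N`
  -- under an invertible affine map.
  have h2 := (Measure.ae_ae_comm hmeas).1 h1
  obtain ⟨s, hs, hs0⟩ := (h2.and (Measure.ae_ne volume (0 : ℝ))).exists
  rw [ae_iff] at hs
  simp only [not_not] at hs
  have h3 : {v : E | p + s • v ∈ N} = (s • ·) ⁻¹' ((p + ·) ⁻¹' N) := rfl
  rw [h3, Measure.addHaar_preimage_smul μ hs0, measure_preimage_add] at hs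
  simpa [hs0] using hs

/-- At a nearby point `s₁` of surjectivity, lift the standard basis to vectors `w j`. The
determinant of the matrix with columns `J s (w j)` is analytic in `s` and equals `1` at `s₁`, so it
does not vanish identically and its zeros are isolated. -/
lemma AnalyticAt.eventually_surjective_of_frequently {E : Type*} [NormedAddCommGroup E]
    [NormedSpace ℝ E] {d : ℕ} {J : ℝ → E →L[ℝ] EuclideanSpace ℝ (Fin d)} {s₀ : ℝ}
    (hJ : AnalyticAt ℝ J s₀) (h : ∃ᶠ s in 𝓝 s₀, Function.Surjective (J s)) :
    ∀ᶠ s in 𝓝[≠] s₀, Function.Surjective (J s) := by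
  obtain ⟨ε, hε, hball⟩ := Metric.eventually_nhds_iff_ball.1 hJ.eventually_analyticAt
  obtain ⟨s₁, hs₁, hmem⟩ := (h.and_eventually (Metric.ball_mem_nhds s₀ hε)).exists
  choose w hw using fun j : Fin d ↦ hs₁ (EuclideanSpace.single j 1)
  let A : ℝ → Matrix (Fin d) (Fin d) ℝ := fun s ↦ Matrix.of fun i j ↦ J s (w j) i
  have hA1 : A s₁ = 1 := by
    ext i j
    simp [A, hw, Matrix.one_apply]
  have hAan : AnalyticOnNhd ℝ (fun s ↦ (A s).det) (Metric.ball s₀ ε) := by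
    intro s hs
    simp only [Matrix.det_apply']
    refine Finset.analyticAt_fun_sum _ fun σ _ ↦ ?_
    refine analyticAt_const.fun_mul (Finset.analyticAt_fun_prod _ fun i _ ↦ ?_)
    have h1 : AnalyticAt ℝ (fun s ↦ J s (w i)) s :=
      AnalyticAt.comp (g := ContinuousLinearMap.apply ℝ (EuclideanSpace ℝ (Fin d)) (w i)) (f := J)
        ((ContinuousLinearMap.apply ℝ (EuclideanSpace ℝ (Fin d)) (w i)).analyticAt _) (hball s hs)
    exact AnalyticAt.comp (g := (EuclideanSpace.proj (σ i) : EuclideanSpace ℝ (Fin d) →L[ℝ] ℝ))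
      (f := fun s ↦ J s (w i)) (ContinuousLinearMap.analyticAt _ _) h1
  have hsurj : ∀ s, (A s).det ≠ 0 → Function.Surjective (J s) := by
    intro s hs y
    have hu : IsUnit (A s).det := isUnit_iff_ne_zero.2 hs
    refine ⟨∑ j, ((A s)⁻¹.mulVec y) j • w j, ?_⟩
    ext i
    have h2 : ((A s).mulVec ((A s)⁻¹.mulVec y)) i = y i := by
      rw [Matrix.mulVec_mulVec, Matrix.mul_nonsing_inv _ hu, Matrix.one_mulVec]
    rw [← h2, Matrix.mulVec, dotProduct]
    simp only [map_sum, map_smul]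
    simp [A, mul_comm]
  rcases (hAan s₀ (Metric.mem_ball_self hε)).eventually_eq_zero_or_eventually_ne_zero with h0 | h0
  · have h3 := hAan.eqOn_zero_of_preconnected_of_eventuallyEq_zero
      (convex_ball s₀ ε).isPreconnected (Metric.mem_ball_self hε) h0 hmem
    simp [hA1] at h3
  · exact h0.mono hsurj

/-- If near every point a property of reals that holds frequently holds on a punctured
neighbourhood, then it holds almost everywhere as soon as it holds somewhere. -/
lemma volume_setOf_not_eq_zero_of_frequently_imp {P : ℝ → Prop} {s₁ : ℝ} (h1 : P s₁)
    (h : ∀ s₀, (∃ᶠ s in 𝓝 s₀, P s) → ∀ᶠ s in 𝓝[≠] s₀, P s) : volume {s | ¬ P s} = 0 := by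
  -- The closure of the good set is clopen, hence everything. Each point then has a neighbourhood in
  -- which it is the only possible bad point.
  have hcl : IsClopen (closure {s | P s}) := by
    refine ⟨isClosed_closure, isOpen_iff_mem_nhds.2 fun s₀ hs₀ ↦ ?_⟩
    have h2 := eventually_nhdsWithin_iff.1 (h s₀ (mem_closure_iff_frequently.1 hs₀))
    filter_upwards [h2] with s hs
    rcases eq_or_ne s s₀ with rfl | hne
    · exact hs₀
    · exact subset_closure (hs hne)
  have huniv := hcl.eq_univ ⟨s₁, subset_closure h1⟩
  refine measure_null_of_locally_null _ fun s₀ _ ↦ ?_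
  have h2 := h s₀ (mem_closure_iff_frequently.1 (huniv.ge (Set.mem_univ s₀)))
  refine ⟨{s₀}, ?_, by simp⟩
  rw [mem_nhdsWithin_iff_eventually]
  filter_upwards [eventually_nhdsWithin_iff.1 h2] with s hs hns
  by_contra hne
  exact hns (hs hne)

end NullSets

/-! ### Uniform measure bounds for submersions with a parameter. -/

section Submersions

variable {E F : Type*} [NormedAddCommGroup E] [NormedSpace ℝ E] [FiniteDimensional ℝ E]
  [MeasurableSpace E] [BorelSpace E] (μ : Measure E) [μ.IsAddHaarMeasure]
  [NormedAddCommGroup F] [NormedSpace ℝ F] [FiniteDimensional ℝ F]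
  [MeasurableSpace F] [BorelSpace F] (lam : Measure F) [lam.IsAddHaarMeasure]

/-- Locally, a submersion that depends on a parameter maps sets of large measure to sets of large
measure, uniformly in the parameter. -/
theorem HasStrictFDerivAt.exists_measure_le_mul_image {f : E × F → F} {D : E × F →L[ℝ] F} {t₀ : E}
    {z₀ : F} (hf : HasStrictFDerivAt f D (t₀, z₀))
    (hD : Function.Surjective (D ∘L .inl ℝ E F)) :
    ∃ C : NNReal, ∃ ε > 0, ∀ z ∈ Metric.ball z₀ ε, ∀ S ⊆ Metric.ball t₀ ε, MeasurableSet S →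
      μ S ≤ C * lam ((fun t ↦ f (t, z)) '' S) := by
  -- On the slices `u ↦ t + R u` the map is close to the identity of `F` plus a constant, so it
  -- shrinks measure by a factor of at most `2`.
  obtain ⟨R, hR⟩ := (D ∘L .inl ℝ E F).exists_rightInverse_of_surjective
    (LinearMap.range_eq_top.2 hD)
  have hRa : ∀ u, D (R u, 0) = u := fun u ↦ DFunLike.congr_fun hR u
  have hdet : (((1 / 2 : NNReal) : NNReal) : ENNReal) <
      ENNReal.ofReal |(ContinuousLinearMap.id ℝ F).det| := by
    have : (ContinuousLinearMap.id ℝ F).det = 1 := by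
      simp [ContinuousLinearMap.det]
    rw [this]
    simp
  obtain ⟨δ, hδ, hδ0⟩ := ((mul_le_addHaar_image_of_lt_det lam (.id ℝ F) hdet).and
    self_mem_nhdsWithin).exists
  have hδ0' : (0 : ℝ) < δ := hδ0
  have hc : 0 < (δ : ℝ) / (‖R‖ + 1) := by positivity
  have h1 := hf.isLittleO.def hc
  rw [nhds_prod_eq, Filter.eventually_prod_self_iff'] at h1
  obtain ⟨W, hW, hWf⟩ := h1
  obtain ⟨ε, hε, hεW⟩ := Metric.mem_nhds_iff.1 hW
  have hslice : ∀ z ∈ Metric.ball z₀ ε, ∀ S ⊆ Metric.ball t₀ ε, ∀ t : E,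
      lam {u : F | t + R u ∈ S} ≤ 2 * lam ((fun t ↦ f (t, z)) '' S) := by
    intro z hz S hS t
    have happ : ApproximatesLinearOn (fun u ↦ f (t + R u, z)) (.id ℝ F) {u : F | t + R u ∈ S} δ := by
      intro u hu u' hu'
      have hm : ∀ u, t + R u ∈ S → (t + R u, z) ∈ W := fun u hu ↦ hεW (by
        rw [← ball_prod_same]
        exact ⟨hS hu, hz⟩)
      have h2 := hWf _ (hm u hu) _ (hm u' hu')
      have h3 : ((t + R u, z) : E × F) - (t + R u', z) = (R (u - u'), 0) := by
        simp
      simp only [h3, hRa] at h2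
      refine h2.trans ?_
      have h4 : ‖((R (u - u'), 0) : E × F)‖ ≤ ‖R‖ * ‖u - u'‖ := by
        rw [Prod.norm_mk, norm_zero, max_eq_left (norm_nonneg _)]
        exact R.le_opNorm _
      calc (δ : ℝ) / (‖R‖ + 1) * ‖((R (u - u'), 0) : E × F)‖
          ≤ (δ : ℝ) / (‖R‖ + 1) * (‖R‖ * ‖u - u'‖) := by gcongr
        _ = δ * (‖R‖ / (‖R‖ + 1)) * ‖u - u'‖ := by ring
        _ ≤ δ * 1 * ‖u - u'‖ := by
            gcongr
            rw [div_le_one (by positivity)]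
            linarith
        _ = δ * ‖u - u'‖ := by ring
    have h5 := hδ _ _ happ
    have h6 : lam {u : F | t + R u ∈ S} =
        2 * (((1 / 2 : NNReal) : NNReal) * lam {u : F | t + R u ∈ S}) := by
      rw [← mul_assoc]
      simp [ENNReal.mul_inv_cancel]
    rw [h6]
    gcongr
    refine h5.trans (measure_mono ?_)
    rintro _ ⟨u, hu, rfl⟩
    exact ⟨_, hu, rfl⟩
  -- The slice bound is averaged over `t`, with `u` in the unit ball `B`. By translation invariance
  -- this recovers `lam B * μ S`, and only `t` in the enlarged ball `K` contribute, since `‖R u‖ ≤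
  -- ‖R‖`.
  set B := Metric.ball (0 : F) 1
  set K := Metric.ball t₀ (ε + ‖R‖)
  have hB0 : lam B ≠ 0 := (Metric.measure_ball_pos lam 0 one_pos).ne'
  have hBt : lam B ≠ ⊤ := measure_ball_lt_top.ne
  have hKt : μ K ≠ ⊤ := measure_ball_lt_top.ne
  refine ⟨((lam B)⁻¹ * (2 * μ K)).toNNReal, ε, hε, fun z hz S hS hSm ↦ ?_⟩
  rw [ENNReal.coe_toNNReal (by finiteness)]
  have hmeas : MeasurableSet {q : F × E | q.2 + R q.1 ∈ S} := by
    have h1 : Measurable fun q : F × E ↦ q.2 + R q.1 := by fun_prop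
    exact h1 hSm
  have e1 : ((lam.restrict B).prod μ) {q : F × E | q.2 + R q.1 ∈ S} = lam B * μ S := by
    rw [Measure.prod_apply hmeas]
    have h2 : ∀ u : F, μ (Prod.mk u ⁻¹' {q : F × E | q.2 + R q.1 ∈ S}) = μ S := fun u ↦
      measure_preimage_add_right μ (R u) S
    rw [lintegral_congr h2, setLIntegral_const, mul_comm]
  have e2 : ((lam.restrict B).prod μ) {q : F × E | q.2 + R q.1 ∈ S} ≤
      2 * lam ((fun t ↦ f (t, z)) '' S) * μ K := by
    rw [Measure.prod_apply_symm hmeas, ← setLIntegral_const]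
    rw [← lintegral_indicator measurableSet_ball]
    refine lintegral_mono fun t ↦ ?_
    by_cases ht : t ∈ K
    · rw [Set.indicator_of_mem ht]
      exact (Measure.restrict_apply_le _ _).trans (hslice z hz S hS t)
    · rw [Set.indicator_of_notMem ht]
      refine le_of_eq ?_
      rw [Measure.restrict_apply' measurableSet_ball]
      convert! measure_empty (μ := lam)
      refine Set.eq_empty_of_forall_notMem fun u ⟨hu, huB⟩ ↦ ht ?_
      have h7 : dist (t + R u) t₀ < ε := hS hu
      have h8 : ‖R u‖ ≤ ‖R‖ := by
        refine (R.le_opNorm u).trans ?_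
        have : ‖u‖ < 1 := by simpa [B] using huB
        nlinarith [norm_nonneg R]
      rw [Metric.mem_ball]
      calc dist t t₀ ≤ dist t (t + R u) + dist (t + R u) t₀ := dist_triangle _ _ _
        _ < ‖R‖ + ε := by
            rw [dist_self_add_right]
            linarith
        _ = ε + ‖R‖ := add_comm _ _
  rw [e1] at e2
  calc μ S = (lam B)⁻¹ * (lam B * μ S) := by
        rw [← mul_assoc, ENNReal.inv_mul_cancel hB0 hBt, one_mul]
    _ ≤ (lam B)⁻¹ * (2 * lam ((fun t ↦ f (t, z)) '' S) * μ K) := by gcongr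
    _ = (lam B)⁻¹ * (2 * μ K) * lam ((fun t ↦ f (t, z)) '' S) := by ring

end Submersions

/-! ### Continuity in `L¹` of compositions with a submersion. -/

section LOneContinuity

variable {E F : Type*} [NormedAddCommGroup E] [NormedSpace ℝ E] [FiniteDimensional ℝ E]
  [MeasurableSpace E] [BorelSpace E] (μ : Measure E) [μ.IsAddHaarMeasure]
  [NormedAddCommGroup F] [NormedSpace ℝ F] [FiniteDimensional ℝ F]
  [MeasurableSpace F] [BorelSpace F]

lemma ContinuousOn.measurableSet_inter_preimage {α β : Type*} [TopologicalSpace α]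
    [MeasurableSpace α] [OpensMeasurableSpace α] [TopologicalSpace β] [MeasurableSpace β]
    [BorelSpace β] {φ : α → β} {K : Set α} (hφ : ContinuousOn φ K) (hK : MeasurableSet K)
    {A : Set β} (hA : MeasurableSet A) : MeasurableSet (K ∩ φ ⁻¹' A) := by
  have h1 : MeasurableSet (K.domRestrict φ ⁻¹' A) :=
    (continuousOn_iff_continuous_domRestrict.1 hφ).measurable hA
  have h2 := hK.subtype_image h1
  rwa [Set.domRestrict_eq, Set.preimage_comp, Subtype.image_preimage_coe] at h2

/-- Composing a bounded measurable function with a submersion that depends on a parameter gives a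
map that is continuous in the parameter with values in `L¹`, locally. -/
theorem HasStrictFDerivAt.exists_tendsto_lintegral_comp {f : E × F → F} {D : E × F →L[ℝ] F}
    {t₀ : E} {z₀ : F} (hf : HasStrictFDerivAt f D (t₀, z₀))
    (hD : Function.Surjective (D ∘L .inl ℝ E F))
    (hcont : ∀ᶠ q in 𝓝 (t₀, z₀), ContinuousAt f q) {G : F → ℝ} (hG : Measurable G) {b : ℝ}
    (hb : ∀ y, |G y| ≤ b) :
    ∃ K ∈ 𝓝 t₀, Filter.Tendsto (fun z ↦ ∫⁻ t in K, ‖G (f (t, z)) - G (f (t, z₀))‖ₑ ∂μ)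
      (𝓝 z₀) (𝓝 0) := by
  let lam : Measure F := Measure.addHaar
  obtain ⟨C, ε₁, hε₁, hC⟩ := hf.exists_measure_le_mul_image μ lam hD
  have hnear : ∀ᶠ q in 𝓝 (t₀, z₀), ContinuousAt f q ∧ f q ∈ Metric.ball (f (t₀, z₀)) 1 :=
    hcont.and (hcont.self_of_nhds.eventually (Metric.ball_mem_nhds _ one_pos))
  obtain ⟨ε₂, hε₂, hnear⟩ := Metric.eventually_nhds_iff_ball.1 hnear
  set ε := min ε₁ ε₂ with hεdef
  have hε : 0 < ε := lt_min hε₁ hε₂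
  set K := Metric.ball t₀ ε with hK
  have hKm : MeasurableSet K := measurableSet_ball
  have hKt : μ K ≠ ⊤ := measure_ball_lt_top.ne
  have hq : ∀ t ∈ K, ∀ z ∈ Metric.ball z₀ ε,
      ContinuousAt f (t, z) ∧ f (t, z) ∈ Metric.ball (f (t₀, z₀)) 1 := by
    intro t ht z hz
    refine hnear (t, z) ?_
    rw [← ball_prod_same]
    exact ⟨Metric.ball_subset_ball (min_le_right _ _) ht,
      Metric.ball_subset_ball (min_le_right _ _) hz⟩
  have hz₀ : z₀ ∈ Metric.ball z₀ ε := Metric.mem_ball_self hε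
  have hcontK : ∀ z ∈ Metric.ball z₀ ε, ContinuousOn (fun t ↦ f (t, z)) K := fun z hz t ht ↦
    (ContinuousAt.comp (g := f) (f := fun t ↦ (t, z)) (hq t ht z hz).1
      (by fun_prop)).continuousWithinAt
  have hae : ∀ z ∈ Metric.ball z₀ ε, AEMeasurable (fun t ↦ f (t, z)) (μ.restrict K) :=
    fun z hz ↦ (hcontK z hz).aemeasurable hKm
  have hmap : ∀ z ∈ Metric.ball z₀ ε,
      (μ.restrict K).map (fun t ↦ f (t, z)) ≤ (C : ENNReal) • lam := by
    intro z hz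
    refine Measure.le_iff.2 fun A hA ↦ ?_
    rw [Measure.map_apply_of_aemeasurable (hae z hz) hA, Measure.restrict_apply' hKm,
      Set.inter_comm]
    refine (hC z (Metric.ball_subset_ball (min_le_left _ _) hz) _
      (Set.inter_subset_left.trans (Metric.ball_subset_ball (min_le_left _ _)))
      ((hcontK z hz).measurableSet_inter_preimage hKm hA)).trans ?_
    rw [Measure.smul_apply, smul_eq_mul]
    gcongr
    rintro _ ⟨t, ht, rfl⟩
    exact ht.2
  have hlint : ∀ z ∈ Metric.ball z₀ ε, ∀ H : F → ENNReal, Measurable H →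
      ∫⁻ t in K, H (f (t, z)) ∂μ ≤ C * ∫⁻ y, H y ∂lam := by
    intro z hz H hH
    rw [← lintegral_map' hH.aemeasurable (hae z hz), ← smul_eq_mul, ← lintegral_smul_measure]
    exact lintegral_mono' (hmap z hz) le_rfl
  set B := Metric.ball (f (t₀, z₀)) 1
  have hG1 : Integrable (B.indicator G) lam := by
    rw [integrable_indicator_iff measurableSet_ball]
    refine Measure.integrableOn_of_bounded (M := b) measure_ball_lt_top.ne
      hG.aestronglyMeasurable (Filter.Eventually.of_forall fun y ↦ ?_)
    simpa using hb y
  refine ⟨K, Metric.ball_mem_nhds t₀ hε, ENNReal.tendsto_nhds_zero.2 fun η hη ↦ ?_⟩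
  obtain ⟨η', hη', hη'η⟩ : ∃ η' : ENNReal, 0 < η' ∧ C * η' + η' + C * η' ≤ η := by
    refine ⟨min η 1 / (2 * C + 1), ?_, ?_⟩
    · exact ENNReal.div_pos (lt_min hη one_pos).ne' (by finiteness)
    · have : C * (min η 1 / (2 * C + 1)) + min η 1 / (2 * C + 1) + C * (min η 1 / (2 * C + 1)) =
          (2 * C + 1) * (min η 1 / (2 * C + 1)) := by ring
      rw [this, ENNReal.mul_div_cancel (by simp) (by finiteness)]
      exact min_le_left _ _
  -- The error of approximating `G` by the continuous `G'` is made small in `L¹(lam)`. By `hlint` it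
  -- stays small after composition with `f(·, z)`, uniformly in `z`; this accounts for the two terms
  -- `C * η'`. The middle term, with `G'` alone, is handled by dominated convergence.
  obtain ⟨G', hG'c, hG'l, hG', -⟩ := hG1.exists_hasCompactSupport_lintegral_sub_le hη'.ne'
  obtain ⟨b', hb'⟩ := hG'c.exists_bound_of_continuous hG'
  set H : F → ENNReal := fun y ↦ ‖B.indicator G y - G' y‖ₑ with hH
  have hHm : Measurable H := ((hG.indicator measurableSet_ball).sub hG'.measurable).enorm
  have hmid : Filter.Tendsto (fun z ↦ ∫⁻ t in K, ‖G' (f (t, z)) - G' (f (t, z₀))‖ₑ ∂μ)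
      (𝓝 z₀) (𝓝 0) := by
    have h0 : ∫⁻ t in K, (0 : ENNReal) ∂μ = 0 := by simp
    rw [← h0]
    have hev : ∀ᶠ z in 𝓝 z₀, z ∈ Metric.ball z₀ ε := Metric.ball_mem_nhds z₀ hε
    refine tendsto_lintegral_filter_of_dominated_convergence' (fun _ ↦ ENNReal.ofReal (b' + b'))
      ?_ ?_ ?_ ?_
    · filter_upwards [hev] with z hz
      exact ((hG'.measurable.comp_aemeasurable (hae z hz)).sub
        (hG'.measurable.comp_aemeasurable (hae z₀ hz₀))).enorm
    · refine Filter.Eventually.of_forall fun z ↦ Filter.Eventually.of_forall fun t ↦ ?_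
      rw [← ofReal_norm]
      exact ENNReal.ofReal_le_ofReal ((norm_sub_le _ _).trans (add_le_add (hb' _) (hb' _)))
    · rw [setLIntegral_const]
      finiteness
    · filter_upwards [ae_restrict_mem hKm] with t ht
      have h1 : ContinuousAt (fun z ↦ f (t, z)) z₀ :=
        ContinuousAt.comp (g := f) (f := fun z ↦ (t, z)) (hq t ht z₀ hz₀).1 (by fun_prop)
      have h2 : ContinuousAt (fun z ↦ ‖G' (f (t, z)) - G' (f (t, z₀))‖ₑ) z₀ :=
        ((hG'.continuousAt.comp h1).sub continuousAt_const).enorm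
      simpa using h2.tendsto
  filter_upwards [Metric.ball_mem_nhds z₀ hε, (ENNReal.tendsto_nhds_zero.1 hmid) η' hη']
    with z hz hzm
  calc ∫⁻ t in K, ‖G (f (t, z)) - G (f (t, z₀))‖ₑ ∂μ
      ≤ ∫⁻ t in K, (H (f (t, z)) + ‖G' (f (t, z)) - G' (f (t, z₀))‖ₑ) + H (f (t, z₀)) ∂μ := by
        refine setLIntegral_mono' hKm fun t ht ↦ ?_
        have e1 : G (f (t, z)) = B.indicator G (f (t, z)) :=
          (Set.indicator_of_mem (hq t ht z hz).2 _).symm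
        have e2 : G (f (t, z₀)) = B.indicator G (f (t, z₀)) :=
          (Set.indicator_of_mem (hq t ht z₀ hz₀).2 _).symm
        rw [e1, e2]
        have e3 : B.indicator G (f (t, z)) - B.indicator G (f (t, z₀)) =
            (B.indicator G (f (t, z)) - G' (f (t, z))) + (G' (f (t, z)) - G' (f (t, z₀))) -
              (B.indicator G (f (t, z₀)) - G' (f (t, z₀))) := by ring
        rw [e3]
        exact enorm_sub_le.trans (by gcongr; exact enorm_add_le _ _)
    _ = ∫⁻ t in K, H (f (t, z)) ∂μ + ∫⁻ t in K, ‖G' (f (t, z)) - G' (f (t, z₀))‖ₑ ∂μ +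
          ∫⁻ t in K, H (f (t, z₀)) ∂μ := by
        rw [lintegral_add_right', lintegral_add_left']
        · exact hHm.comp_aemeasurable (hae z hz)
        · exact hHm.comp_aemeasurable (hae z₀ hz₀)
    _ ≤ C * η' + η' + C * η' := by
        gcongr
        · exact (hlint z hz H hHm).trans (by gcongr)
        · exact (hlint z₀ hz₀ H hHm).trans (by gcongr)
    _ ≤ η := hη'η

end LOneContinuity

/-! ### Openness and almost sure validity of the submersion property. -/

section ManifoldSubmersions

variable {d : ℕ} {M : Type*} [TopologicalSpace M] [ChartedSpace (EuclideanSpace ℝ (Fin d)) M]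
  {E : Type*} [NormedAddCommGroup E] [NormedSpace ℝ E]

lemma surjective_mfderiv_iff_fderiv_extChartAt [IsManifold (𝓡 d) 1 M] {φ : E → M} {t : E} {y₀ : M}
    (hφ : MDifferentiableAt 𝓘(ℝ, E) (𝓡 d) φ t) (hy : φ t ∈ (extChartAt (𝓡 d) y₀).source) :
    Function.Surjective (mfderiv 𝓘(ℝ, E) (𝓡 d) φ t) ↔
      Function.Surjective (fderiv ℝ (extChartAt (𝓡 d) y₀ ∘ φ) t) := by
  have he : MDifferentiableAt (𝓡 d) (𝓡 d) (extChartAt (𝓡 d) y₀) (φ t) :=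
    mdifferentiableAt_extChartAt (by rwa [extChartAt_source] at hy)
  have h1 := mfderiv_comp t he hφ
  rw [← mfderiv_eq_fderiv, h1]
  have hinv := isInvertible_mfderiv_extChartAt (I := 𝓡 d) hy
  exact ⟨fun h ↦ hinv.surjective.comp h, fun h ↦ Function.Surjective.of_comp_left h hinv.injective⟩

variable [IsManifold (𝓡 d) ω M] {Φ : E × M → M}

/-- The coordinate expression of a family of maps into a manifold that depends on a point of the
manifold. -/
noncomputable def chartFamily (x₀ y₀ : M) (Φ : E × M → M)
    (q : E × EuclideanSpace ℝ (Fin d)) : EuclideanSpace ℝ (Fin d) :=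
  extChartAt (𝓡 d) y₀ (Φ (q.1, (extChartAt (𝓡 d) x₀).symm q.2))

lemma contDiffAt_chartFamily (hΦ : ContMDiff (𝓘(ℝ, E).prod (𝓡 d)) (𝓡 d) ω Φ) {x₀ y₀ x : M} {t : E}
    (hx : x ∈ (extChartAt (𝓡 d) x₀).source) (hy : Φ (t, x) ∈ (extChartAt (𝓡 d) y₀).source) :
    ContDiffAt ℝ ω (chartFamily x₀ y₀ Φ) (t, extChartAt (𝓡 d) x₀ x) := by
  have h1 : ContMDiffAt (𝓘(ℝ, E).prod (𝓡 d)) (𝓘(ℝ, E).prod (𝓡 d)) ω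
      (fun q : E × EuclideanSpace ℝ (Fin d) ↦ (q.1, (extChartAt (𝓡 d) x₀).symm q.2))
      (t, extChartAt (𝓡 d) x₀ x) := by
    refine contMDiffAt_fst.prodMk (ContMDiffAt.comp (g := (extChartAt (𝓡 d) x₀).symm) _ ?_
      contMDiffAt_snd)
    exact contMDiffAt_extChartAt_symm_target ((extChartAt (𝓡 d) x₀).map_source hx)
  have h2 : ContMDiffAt (𝓘(ℝ, E).prod (𝓡 d)) (𝓡 d) ω
      (fun q : E × EuclideanSpace ℝ (Fin d) ↦ Φ (q.1, (extChartAt (𝓡 d) x₀).symm q.2))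
      (t, extChartAt (𝓡 d) x₀ x) := ContMDiffAt.comp (g := Φ) _ (hΦ _) h1
  have h3 : ContMDiffAt (𝓘(ℝ, E).prod (𝓡 d)) (𝓡 d) ω
      (chartFamily x₀ y₀ Φ) (t, extChartAt (𝓡 d) x₀ x) := by
    refine ContMDiffAt.comp (g := extChartAt (𝓡 d) y₀) _ (contMDiffAt_extChartAt' ?_) h2
    rw [extChartAt_source] at hy
    rwa [(extChartAt (𝓡 d) x₀).left_inv hx]
  rw [← contMDiffAt_iff_contDiffAt, modelWithCornersSelf_prod, ← chartedSpaceSelf_prod]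
  exact h3

lemma surjective_mfderiv_iff_chartFamily (hΦ : ContMDiff (𝓘(ℝ, E).prod (𝓡 d)) (𝓡 d) ω Φ)
    {x₀ y₀ x : M} {t : E} (hx : x ∈ (extChartAt (𝓡 d) x₀).source)
    (hy : Φ (t, x) ∈ (extChartAt (𝓡 d) y₀).source) :
    Function.Surjective (mfderiv 𝓘(ℝ, E) (𝓡 d) (fun t ↦ Φ (t, x)) t) ↔
      Function.Surjective (fderiv ℝ (chartFamily x₀ y₀ Φ) (t, extChartAt (𝓡 d) x₀ x) ∘L
        .inl ℝ E (EuclideanSpace ℝ (Fin d))) := by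
  have h1 : ContMDiffAt 𝓘(ℝ, E) (𝓡 d) ω (fun t ↦ Φ (t, x)) t :=
    ContMDiffAt.comp (g := Φ) t (hΦ _) (contMDiffAt_id.prodMk contMDiffAt_const)
  rw [surjective_mfderiv_iff_fderiv_extChartAt (h1.mdifferentiableAt (by simp)) hy]
  have h2 : extChartAt (𝓡 d) y₀ ∘ (fun t ↦ Φ (t, x)) =
      fun t ↦ chartFamily x₀ y₀ Φ (t, extChartAt (𝓡 d) x₀ x) := by
    ext1 t
    simp only [chartFamily, (extChartAt (𝓡 d) x₀).left_inv hx, Function.comp_apply]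
  have h3 : HasFDerivAt (fun t ↦ chartFamily x₀ y₀ Φ (t, extChartAt (𝓡 d) x₀ x))
      (fderiv ℝ (chartFamily x₀ y₀ Φ) (t, extChartAt (𝓡 d) x₀ x) ∘L
        .inl ℝ E (EuclideanSpace ℝ (Fin d))) t :=
    HasFDerivAt.comp (g := chartFamily x₀ y₀ Φ) (f := fun t ↦ (t, extChartAt (𝓡 d) x₀ x)) t
      ((contDiffAt_chartFamily hΦ hx hy).differentiableAt (by simp)).hasFDerivAt
      (hasFDerivAt_prodMk_left t (extChartAt (𝓡 d) x₀ x))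
  rw [h2, h3.fderiv]

/-- In coordinates, compose the derivative with a fixed right inverse `R` of its value at the base
point. The composition is the identity there, hence invertible nearby, which forces surjectivity. -/
lemma eventually_surjective_mfderiv (hΦ : ContMDiff (𝓘(ℝ, E).prod (𝓡 d)) (𝓡 d) ω Φ)
    {x₀ : M} {t₀ : E}
    (h : Function.Surjective (mfderiv 𝓘(ℝ, E) (𝓡 d) (fun t ↦ Φ (t, x₀)) t₀)) :
    ∀ᶠ p in 𝓝 (t₀, x₀),
      Function.Surjective (mfderiv 𝓘(ℝ, E) (𝓡 d) (fun t ↦ Φ (t, p.2)) p.1) := by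
  set y₀ := Φ (t₀, x₀) with hy₀
  set f := chartFamily (d := d) x₀ y₀ Φ
  have hx : x₀ ∈ (extChartAt (𝓡 d) x₀).source := mem_extChartAt_source x₀
  have hy : Φ (t₀, x₀) ∈ (extChartAt (𝓡 d) y₀).source := mem_extChartAt_source y₀
  rw [surjective_mfderiv_iff_chartFamily hΦ hx hy] at h
  obtain ⟨R, hR⟩ := ContinuousLinearMap.exists_rightInverse_of_surjective _
    (LinearMap.range_eq_top.2 h)
  have hcoord : ContinuousAt (fun p : E × M ↦ (p.1, extChartAt (𝓡 d) x₀ p.2)) (t₀, x₀) :=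
    continuousAt_fst.prodMk (ContinuousAt.comp (g := extChartAt (𝓡 d) x₀) (f := Prod.snd)
      (continuousAt_extChartAt x₀) continuousAt_snd)
  have hfd : ContinuousAt (fderiv ℝ f) (t₀, extChartAt (𝓡 d) x₀ x₀) :=
    ((contDiffAt_chartFamily hΦ hx hy).fderiv_right (m := 0) (by simp)).continuousAt
  have hcomp : ContinuousAt (fun p : E × M ↦
      (fderiv ℝ f (p.1, extChartAt (𝓡 d) x₀ p.2) ∘L .inl ℝ E (EuclideanSpace ℝ (Fin d))) ∘L R)
      (t₀, x₀) :=
    ((ContinuousAt.comp (g := fderiv ℝ f)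
      (f := fun p : E × M ↦ (p.1, extChartAt (𝓡 d) x₀ p.2)) hfd hcoord).clm_comp continuousAt_const).clm_comp
      continuousAt_const
  have hunit : ∀ᶠ p in 𝓝 (t₀, x₀), IsUnit
      ((fderiv ℝ f (p.1, extChartAt (𝓡 d) x₀ p.2) ∘L .inl ℝ E (EuclideanSpace ℝ (Fin d))) ∘L R) := by
    refine hcomp.eventually (Units.isOpen.mem_nhds ?_)
    simp only [f, hR]
    exact isUnit_one
  have h1 : ∀ᶠ p in 𝓝 (t₀, x₀), p.2 ∈ (extChartAt (𝓡 d) x₀).source :=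
    continuousAt_snd.eventually (extChartAt_source_mem_nhds x₀)
  have h2 : ∀ᶠ p in 𝓝 (t₀, x₀), Φ p ∈ (extChartAt (𝓡 d) y₀).source :=
    hΦ.continuous.continuousAt.eventually (extChartAt_source_mem_nhds y₀)
  filter_upwards [hunit, h1, h2] with p hp hp1 hp2
  rw [surjective_mfderiv_iff_chartFamily hΦ hp1 hp2]
  have h3 := (ContinuousLinearMap.isUnit_iff_bijective.1 hp).surjective
  exact Function.Surjective.of_comp h3

/-- If an analytic map into a manifold is a submersion at one point, then it is a submersion at
almost every point. -/
theorem ae_surjective_mfderiv [FiniteDimensional ℝ E] [MeasurableSpace E] [BorelSpace E]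
    (μ : Measure E) [μ.IsAddHaarMeasure] (hΦ : ContMDiff (𝓘(ℝ, E).prod (𝓡 d)) (𝓡 d) ω Φ)
    {x : M} {t₁ : E}
    (h : Function.Surjective (mfderiv 𝓘(ℝ, E) (𝓡 d) (fun t ↦ Φ (t, x)) t₁)) :
    ∀ᵐ t ∂μ, Function.Surjective (mfderiv 𝓘(ℝ, E) (𝓡 d) (fun t ↦ Φ (t, x)) t) := by
  set φ : E → M := fun t ↦ Φ (t, x) with hφdef
  have hφ : ContMDiff 𝓘(ℝ, E) (𝓡 d) ω φ := hΦ.comp (contMDiff_id.prodMk contMDiff_const)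
  have hopen : IsOpen {t | Function.Surjective (mfderiv 𝓘(ℝ, E) (𝓡 d) φ t)} := by
    refine isOpen_iff_mem_nhds.2 fun t ht ↦ ?_
    have h1 := eventually_surjective_mfderiv hΦ ht
    have h2 : ContinuousAt (fun t : E ↦ (t, x)) t := by fun_prop
    exact h2.eventually h1
  rw [ae_iff]
  -- Every line through `t₁` contains a submersion point, namely `t₁`, so one-variable analyticity
  -- suffices. Charts cover the line only locally, and its connectedness joins the local
  -- conclusions.
  refine Measure.measure_eq_zero_of_null_on_lines μ hopen.measurableSet.compl t₁ fun v ↦ ?_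
  refine volume_setOf_not_eq_zero_of_frequently_imp (s₁ := 0)
    (P := fun s : ℝ ↦ Function.Surjective (mfderiv 𝓘(ℝ, E) (𝓡 d) φ (t₁ + s • v)))
    (by rwa [zero_smul, add_zero]) fun s₀ hs₀ ↦ ?_
  set y₀ := φ (t₁ + s₀ • v)
  set e := extChartAt (𝓡 d) y₀ with he
  have hline : AnalyticAt ℝ (fun s : ℝ ↦ t₁ + s • v) s₀ := by fun_prop
  have hdf : ContDiffAt ℝ ω (e ∘ φ) (t₁ + s₀ • v) :=
    ContMDiffAt.contDiffAt (ContMDiffAt.comp _ contMDiffAt_extChartAt (hφ _))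
  have hJ : AnalyticAt ℝ (fun s : ℝ ↦ fderiv ℝ (e ∘ φ) (t₁ + s • v)) s₀ :=
    AnalyticAt.comp (g := fderiv ℝ (e ∘ φ)) (f := fun s : ℝ ↦ t₁ + s • v)
      hdf.analyticAt.fderiv hline
  have hiff : ∀ᶠ s in 𝓝 s₀, (Function.Surjective (mfderiv 𝓘(ℝ, E) (𝓡 d) φ (t₁ + s • v)) ↔
      Function.Surjective (fderiv ℝ (e ∘ φ) (t₁ + s • v))) := by
    have h1 : ContinuousAt (fun s : ℝ ↦ φ (t₁ + s • v)) s₀ :=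
      ContinuousAt.comp (g := φ) hφ.continuous.continuousAt hline.continuousAt
    filter_upwards [h1.eventually (extChartAt_source_mem_nhds (I := 𝓡 d) y₀)] with s hs
    exact surjective_mfderiv_iff_fderiv_extChartAt ((hφ _).mdifferentiableAt (by simp)) hs
  have h2 := hJ.eventually_surjective_of_frequently
    ((hs₀.and_eventually hiff).mono fun s hs ↦ hs.2.1 hs.1)
  filter_upwards [h2, nhdsWithin_le_nhds hiff] with s hs1 hs2
  exact hs2.2 hs1

end ManifoldSubmersions

/-! ### From submersions to the strong Feller property. -/

section StrongFeller

variable {d : ℕ} {M : Type*} [TopologicalSpace M] [ChartedSpace (EuclideanSpace ℝ (Fin d)) M]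
  [IsManifold (𝓡 d) ω M] [MeasurableSpace M] [BorelSpace M]
  {E : Type*} [NormedAddCommGroup E] [NormedSpace ℝ E] [FiniteDimensional ℝ E]
  [MeasurableSpace E] [BorelSpace E] (μ : Measure E) [μ.IsAddHaarMeasure] {Φ : E × M → M}

lemma exists_tendsto_lintegral_comp_of_surjective_mfderiv
    (hΦ : ContMDiff (𝓘(ℝ, E).prod (𝓡 d)) (𝓡 d) ω Φ) {x₁ : M} {t₀ : E}
    (hs : Function.Surjective (mfderiv 𝓘(ℝ, E) (𝓡 d) (fun t ↦ Φ (t, x₁)) t₀))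
    {g : M → ℝ} (hg : Measurable g) {b : ℝ} (hb : ∀ y, |g y| ≤ b) :
    ∃ K ∈ 𝓝 t₀, Filter.Tendsto (fun x ↦ ∫⁻ t in K, ‖g (Φ (t, x)) - g (Φ (t, x₁))‖ₑ ∂μ)
      (𝓝 x₁) (𝓝 0) := by
  classical
  set y₀ := Φ (t₀, x₁) with hy₀
  set e := extChartAt (𝓡 d) y₀ with he
  set e₁ := extChartAt (𝓡 d) x₁ with he₁
  set f := chartFamily (d := d) x₁ y₀ Φ with hf
  have hx : x₁ ∈ e₁.source := mem_extChartAt_source x₁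
  have hy : Φ (t₀, x₁) ∈ e.source := mem_extChartAt_source y₀
  have hfd : ContDiffAt ℝ ω f (t₀, e₁ x₁) := contDiffAt_chartFamily hΦ hx hy
  have hcont : ∀ᶠ q in 𝓝 (t₀, e₁ x₁), ContinuousAt f q :=
    (hfd.eventually (by simp)).mono fun q hq ↦ hq.continuousAt
  -- The inverse chart is extended measurably to the whole space. The default value `y₀` is never
  -- met, because `Φ` stays in the chart domain for the `t` and `x` considered.
  let h : EuclideanSpace ℝ (Fin d) → M := e.target.piecewise e.symm (fun _ ↦ y₀)
  have hh : Measurable h := (continuousOn_extChartAt_symm y₀).measurable_piecewise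
    continuousOn_const (isOpen_extChartAt_target y₀).measurableSet
  obtain ⟨K, hK, hKt⟩ := (hfd.hasStrictFDerivAt (by simp)).exists_tendsto_lintegral_comp μ
    ((surjective_mfderiv_iff_chartFamily hΦ hx hy).1 hs) hcont (hg.comp hh) (b := b)
    (fun y ↦ hb _)
  have hsrc : ∀ᶠ p in 𝓝 (t₀, x₁), Φ p ∈ e.source :=
    hΦ.continuous.continuousAt.eventually (extChartAt_source_mem_nhds y₀)
  rw [nhds_prod_eq, Filter.eventually_prod_iff] at hsrc
  obtain ⟨p, hp, q, hq, hpq⟩ := hsrc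
  obtain ⟨K', hK'K, hK'o, hK't⟩ := mem_nhds_iff.1 (Filter.inter_mem hK hp)
  have hval : ∀ t ∈ K', ∀ x, q x → x ∈ e₁.source → g (Φ (t, x)) = (g ∘ h) (f (t, e₁ x)) := by
    intro t ht x hqx hxs
    have h1 : Φ (t, x) ∈ e.source := hpq (hK'K ht).2 hqx
    have h2 : f (t, e₁ x) = e (Φ (t, x)) := by
      simp only [f, chartFamily, he₁]
      rw [(extChartAt (𝓡 d) x₁).left_inv hxs]
    simp only [Function.comp_apply, h2, h]
    rw [Set.piecewise_eq_of_mem _ _ _ (e.map_source h1), e.left_inv h1]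
  have hlim : Filter.Tendsto (fun x ↦ ∫⁻ t in K, ‖(g ∘ h) (f (t, e₁ x)) -
      (g ∘ h) (f (t, e₁ x₁))‖ₑ ∂μ) (𝓝 x₁) (𝓝 0) :=
    hKt.comp (continuousAt_extChartAt x₁)
  refine ⟨K', hK'o.mem_nhds hK't, tendsto_of_tendsto_of_tendsto_of_le_of_le'
    tendsto_const_nhds hlim (Filter.Eventually.of_forall fun _ ↦ zero_le) ?_⟩
  filter_upwards [hq, extChartAt_source_mem_nhds (I := 𝓡 d) x₁] with x hqx hxs
  calc ∫⁻ t in K', ‖g (Φ (t, x)) - g (Φ (t, x₁))‖ₑ ∂μ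
      = ∫⁻ t in K', ‖(g ∘ h) (f (t, e₁ x)) - (g ∘ h) (f (t, e₁ x₁))‖ₑ ∂μ := by
        refine setLIntegral_congr_fun hK'o.measurableSet fun t ht ↦ ?_
        rw [hval t ht x hqx hxs, hval t ht x₁ hq.self_of_nhds hx]
    _ ≤ _ := lintegral_mono_set fun t ht ↦ (hK'K ht).1

/-- Local `L¹` continuity extends to compact subsets `L` of the open submersion set `O` by a finite
cover. Since `ν` is finite and does not charge the complement of `O`, inner regularity makes the
mass off `L` small, and there the integrand is bounded by `2b`. -/
lemma continuousAt_integral_of_ae_surjective_mfderiv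
    (hΦ : ContMDiff (𝓘(ℝ, E).prod (𝓡 d)) (𝓡 d) ω Φ) {ν : Measure E} [IsFiniteMeasure ν]
    {c : NNReal} (hν : ν ≤ (c : ENNReal) • μ) {x₁ : M}
    (hs : ∀ᵐ t ∂μ, Function.Surjective (mfderiv 𝓘(ℝ, E) (𝓡 d) (fun t ↦ Φ (t, x₁)) t))
    {g : M → ℝ} (hg : Measurable g) {b : ℝ} (hb : ∀ y, |g y| ≤ b) :
    ContinuousAt (fun x ↦ ∫ t, g (Φ (t, x)) ∂ν) x₁ := by
  have hmeas : ∀ x, Measurable fun t ↦ g (Φ (t, x)) := fun x ↦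
    hg.comp (hΦ.continuous.comp (by fun_prop : Continuous fun t : E ↦ (t, x))).measurable
  have hint : ∀ x, Integrable (fun t ↦ g (Φ (t, x))) ν := fun x ↦
    Integrable.of_bound (hmeas x).aestronglyMeasurable b
      (Filter.Eventually.of_forall fun t ↦ hb _)
  refine tendsto_integral_of_L1 _ (hint x₁).aestronglyMeasurable
    (Filter.Eventually.of_forall hint) ?_
  set O := {t | Function.Surjective (mfderiv 𝓘(ℝ, E) (𝓡 d) (fun t ↦ Φ (t, x₁)) t)} with hO
  have hOopen : IsOpen O := by
    refine isOpen_iff_mem_nhds.2 fun t ht ↦ ?_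
    have h2 : ContinuousAt (fun t : E ↦ (t, x₁)) t := by fun_prop
    exact h2.eventually (eventually_surjective_mfderiv hΦ ht)
  have hνO : ν Oᶜ = 0 := by
    refine le_antisymm ((hν _).trans ?_) zero_le
    rw [Measure.smul_apply]
    have : μ Oᶜ = 0 := hs
    simp [this]
  have hcompact : ∀ L : Set E, IsCompact L → L ⊆ O →
      Filter.Tendsto (fun x ↦ ∫⁻ t in L, ‖g (Φ (t, x)) - g (Φ (t, x₁))‖ₑ ∂ν) (𝓝 x₁) (𝓝 0) := by
    intro L hL hLO
    refine hL.induction_on (p := fun L ↦ Filter.Tendsto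
      (fun x ↦ ∫⁻ t in L, ‖g (Φ (t, x)) - g (Φ (t, x₁))‖ₑ ∂ν) (𝓝 x₁) (𝓝 0)) ?_ ?_ ?_ ?_
    · simp
    · intro A B hAB hB
      exact tendsto_of_tendsto_of_tendsto_of_le_of_le tendsto_const_nhds hB
        (fun _ ↦ zero_le) fun x ↦ lintegral_mono_set hAB
    · intro A B hA hB
      have h1 := hA.add hB
      rw [add_zero] at h1
      exact tendsto_of_tendsto_of_tendsto_of_le_of_le tendsto_const_nhds h1
        (fun _ ↦ zero_le) fun x ↦ lintegral_union_le _ _ _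
    · intro t ht
      obtain ⟨K, hK, hKt⟩ := exists_tendsto_lintegral_comp_of_surjective_mfderiv μ hΦ (hLO ht) hg hb
      refine ⟨K, mem_nhdsWithin_of_mem_nhds hK, ?_⟩
      have h1 := ENNReal.Tendsto.const_mul hKt (Or.inr (ENNReal.coe_ne_top (r := c)))
      rw [mul_zero] at h1
      refine tendsto_of_tendsto_of_tendsto_of_le_of_le tendsto_const_nhds h1
        (fun _ ↦ zero_le) fun x ↦ ?_
      beta_reduce
      rw [← smul_eq_mul, ← lintegral_smul_measure, ← Measure.restrict_smul]
      exact lintegral_mono' (Measure.restrict_mono le_rfl hν) le_rfl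
  refine ENNReal.tendsto_nhds_zero.2 fun η hη ↦ ?_
  have hη2 : η / 2 ≠ 0 := (ENNReal.half_pos hη.ne').ne'
  -- The `+ 1` in the denominator covers the case `b = 0`.
  obtain ⟨L, hLO, hL, hLν⟩ := hOopen.measurableSet.exists_isCompact_sdiff_lt
    (measure_ne_top ν O) (ε := η / 2 / (ENNReal.ofReal (b + b) + 1))
    (ENNReal.div_pos hη2 (by finiteness)).ne'
  filter_upwards [ENNReal.tendsto_nhds_zero.1 (hcompact L hL hLO) (η / 2) (pos_iff_ne_zero.2 hη2)]
    with x hx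
  have hLc : ν Lᶜ ≤ η / 2 / (ENNReal.ofReal (b + b) + 1) := by
    refine le_trans ?_ hLν.le
    calc ν Lᶜ ≤ ν (O \ L ∪ Oᶜ) := measure_mono fun t ht ↦ by
          by_cases h : t ∈ O
          · exact Or.inl ⟨h, ht⟩
          · exact Or.inr h
      _ ≤ ν (O \ L) + ν Oᶜ := measure_union_le _ _
      _ = ν (O \ L) := by rw [hνO, add_zero]
  rw [← lintegral_add_compl _ hL.measurableSet]
  calc _ ≤ η / 2 + ∫⁻ t in Lᶜ, (ENNReal.ofReal (b + b) + 1) ∂ν := by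
        gcongr with t
        rw [← ofReal_norm]
        exact (ENNReal.ofReal_le_ofReal ((norm_sub_le _ _).trans (add_le_add (hb _) (hb _)))).trans
          le_self_add
    _ ≤ η / 2 + (ENNReal.ofReal (b + b) + 1) * (η / 2 / (ENNReal.ofReal (b + b) + 1)) := by
        rw [setLIntegral_const]
        gcongr
    _ = η := by
        rw [ENNReal.mul_div_cancel (by simp) (by finiteness), ENNReal.add_halves]

/-- If an analytic family of maps is a submersion in the random parameter for one value of the
parameter and at one point, then the corresponding Markov operator is strong Feller near this
point. -/
theorem exists_isOpen_continuousOn_integral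
    (hΦ : ContMDiff (𝓘(ℝ, E).prod (𝓡 d)) (𝓡 d) ω Φ) {ν : Measure E} [IsFiniteMeasure ν]
    {c : NNReal} (hν : ν ≤ (c : ENNReal) • μ) {x₀ : M} {t₀ : E}
    (hs : Function.Surjective (mfderiv 𝓘(ℝ, E) (𝓡 d) (fun t ↦ Φ (t, x₀)) t₀)) :
    ∃ U : Set M, IsOpen U ∧ x₀ ∈ U ∧ ∀ g : M → ℝ, Measurable g → (∃ C : ℝ, ∀ x, |g x| ≤ C) →
      ContinuousOn (fun x ↦ ∫ t, g (Φ (t, x)) ∂ν) U := by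
  have h1 : ContinuousAt (fun x : M ↦ (t₀, x)) x₀ := by fun_prop
  obtain ⟨U, hU, hUo, hxU⟩ := mem_nhds_iff.1 (h1.eventually (eventually_surjective_mfderiv hΦ hs))
  refine ⟨U, hUo, hxU, fun g hg ⟨b, hb⟩ x hx ↦ ContinuousAt.continuousWithinAt ?_⟩
  exact continuousAt_integral_of_ae_surjective_mfderiv μ hΦ hν
    (ae_surjective_mfderiv μ hΦ (hU hx)) hg hb

end StrongFeller

/-! ### Tangency to immersed submanifolds, and maximal rank. -/

section Tangency

variable {E F K : Type*} [NormedAddCommGroup E] [NormedSpace ℝ E]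
  [NormedAddCommGroup F] [NormedSpace ℝ F] [NormedAddCommGroup K] [NormedSpace ℝ K]

/-- A vector field that is tangent to an immersed submanifold is the image of a differentiable
vector field on the source. -/
lemma exists_hasFDerivAt_of_tangent [CompleteSpace K] {ψ : K → F} {k : K} {P : F →L[ℝ] K}
    (hψ : ContDiffAt ℝ 2 ψ k) (hP : IsUnit (P ∘L fderiv ℝ ψ k)) {V : F → F}
    (hV : DifferentiableAt ℝ V (ψ k))
    (hVt : ∀ᶠ l in 𝓝 k, V (ψ l) ∈ Set.range (fderiv ℝ ψ l)) :
    ∃ (v : K) (v' : K →L[ℝ] K), fderiv ℝ ψ k v = V (ψ k) ∧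
      ∀ w, fderiv ℝ V (ψ k) (fderiv ℝ ψ k w) =
        fderiv ℝ (fderiv ℝ ψ) k w v + fderiv ℝ ψ k (v' w) := by
  have hψ' : DifferentiableAt ℝ (fderiv ℝ ψ) k :=
    (hψ.fderiv_right (m := 1) (by norm_num)).differentiableAt (by norm_num)
  have hψd : DifferentiableAt ℝ ψ k := hψ.differentiableAt (by norm_num)
  let B : K → K →L[ℝ] K := fun l ↦ P ∘L fderiv ℝ ψ l
  have hB : DifferentiableAt ℝ B k := (differentiableAt_const P).clm_comp hψ'
  have hBinv : DifferentiableAt ℝ (fun l ↦ Ring.inverse (B l)) k := by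
    have h1 : DifferentiableAt ℝ Ring.inverse (B k) := differentiableAt_inverse hP
    exact DifferentiableAt.comp (g := Ring.inverse) k h1 hB
  -- `B⁻¹ P` is a left inverse of the derivative of `ψ` that varies differentiably, so it lifts `V`
  -- to a differentiable field. The second claim is the derivative of `dψ_l (v l) = V (ψ l)`.
  let v : K → K := fun l ↦ Ring.inverse (B l) (P (V (ψ l)))
  have hVψ : DifferentiableAt ℝ (fun l ↦ V (ψ l)) k := hV.comp k hψd
  have hv : DifferentiableAt ℝ v k :=
    hBinv.clm_apply (P.differentiableAt.comp k hVψ)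
  have hunit : ∀ᶠ l in 𝓝 k, IsUnit (B l) := hB.continuousAt.eventually (Units.isOpen.mem_nhds hP)
  have heq : ∀ᶠ l in 𝓝 k, fderiv ℝ ψ l (v l) = V (ψ l) := by
    filter_upwards [hunit, hVt] with l hl ⟨w, hw⟩
    have h1 : v l = w := by
      have h2 : P (V (ψ l)) = B l w := by rw [← hw]; rfl
      simp only [v, h2]
      exact DFunLike.congr_fun (Ring.inverse_mul_cancel _ hl) w
    rw [h1, hw]
  refine ⟨v k, fderiv ℝ v k, heq.self_of_nhds, fun w ↦ ?_⟩
  have hd1 : HasFDerivAt (fun l ↦ V (ψ l)) (fderiv ℝ V (ψ k) ∘L fderiv ℝ ψ k) k :=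
    hV.hasFDerivAt.comp k hψd.hasFDerivAt
  have hd2 := (hψ'.hasFDerivAt.clm_apply hv.hasFDerivAt).congr_of_eventuallyEq
    (heq.mono fun l hl ↦ hl.symm)
  have h3 := DFunLike.congr_fun (hd1.unique hd2) w
  simp only [ContinuousLinearMap.comp_apply, add_apply,
    ContinuousLinearMap.flip_apply] at h3
  rw [h3, add_comm]

/-- The Lie bracket of two vector fields that are tangent to an immersed submanifold is tangent. -/
lemma lieBracket_mem_range_fderiv [CompleteSpace K] {ψ : K → F} {k : K} {P : F →L[ℝ] K}
    (hψ : ContDiffAt ℝ 2 ψ k) (hP : IsUnit (P ∘L fderiv ℝ ψ k)) {V W : F → F}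
    (hV : DifferentiableAt ℝ V (ψ k)) (hW : DifferentiableAt ℝ W (ψ k))
    (hVt : ∀ᶠ l in 𝓝 k, V (ψ l) ∈ Set.range (fderiv ℝ ψ l))
    (hWt : ∀ᶠ l in 𝓝 k, W (ψ l) ∈ Set.range (fderiv ℝ ψ l)) :
    VectorField.lieBracket ℝ V W (ψ k) ∈ Set.range (fderiv ℝ ψ k) := by
  obtain ⟨v, v', hv, hv'⟩ := exists_hasFDerivAt_of_tangent hψ hP hV hVt
  obtain ⟨w, w', hw, hw'⟩ := exists_hasFDerivAt_of_tangent hψ hP hW hWt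
  -- This is the bracket of the two lifted fields; the second derivatives of `ψ` cancel by symmetry.
  refine ⟨w' v - v' w, ?_⟩
  have hsymm := hψ.isSymmSndFDerivAt (by simp) v w
  rw [VectorField.lieBracket, ← hv, ← hw, hv', hw', hsymm, map_sub]
  abel

/-- Near a point where its rank is maximal, a differentiable map factors locally through an
immersion with the same tangent spaces. -/
lemma exists_immersion_of_maximal_rank [FiniteDimensional ℝ E] [FiniteDimensional ℝ F] {φ : E → F}
    {t₀ : E} (hφ : ContDiffAt ℝ ω φ t₀)
    (hmax : ∀ᶠ t in 𝓝 t₀, Module.finrank ℝ (LinearMap.range (fderiv ℝ φ t : E →ₗ[ℝ] F)) ≤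
      Module.finrank ℝ (LinearMap.range (fderiv ℝ φ t₀ : E →ₗ[ℝ] F))) :
    ∃ (r : ℕ) (ι : EuclideanSpace ℝ (Fin r) →L[ℝ] E) (P : F →L[ℝ] EuclideanSpace ℝ (Fin r)),
      ∀ᶠ k in 𝓝 (0 : EuclideanSpace ℝ (Fin r)),
      IsUnit (P ∘L fderiv ℝ (fun k ↦ φ (t₀ + ι k)) k) ∧
      Set.range (fderiv ℝ (fun k ↦ φ (t₀ + ι k)) k) = Set.range (fderiv ℝ φ (t₀ + ι k)) := by
  set A := fderiv ℝ φ t₀ with hA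
  set S : Submodule ℝ F := LinearMap.range (A : E →ₗ[ℝ] F) with hS
  set K := EuclideanSpace ℝ (Fin (Module.finrank ℝ S))
  obtain ⟨ι₀, hι₀⟩ := (A : E →ₗ[ℝ] F).rangeRestrict.exists_rightInverse_of_surjective
    (LinearMap.range_rangeRestrict _)
  obtain ⟨P₀, hP₀⟩ := S.subtype.exists_leftInverse_of_injective S.ker_subtype
  let e : S ≃ₗ[ℝ] K := LinearEquiv.ofFinrankEq _ _ (by simp [K])
  -- `ι` parametrizes a complement of the kernel of `A`, and `P` projects onto the range of `A`, so
  -- `P A ι` is the identity.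
  let ι : K →L[ℝ] E := LinearMap.toContinuousLinearMap (ι₀ ∘ₗ e.symm)
  let P : F →L[ℝ] K := LinearMap.toContinuousLinearMap (e.toLinearMap ∘ₗ P₀)
  have hPAι : (P ∘L A) ∘L ι = ContinuousLinearMap.id ℝ K := by
    refine ContinuousLinearMap.ext fun k ↦ ?_
    have h1 : A (ι k) = e.symm k := congrArg Subtype.val (DFunLike.congr_fun hι₀ (e.symm k))
    have h2 : P₀ (e.symm k : F) = e.symm k := DFunLike.congr_fun hP₀ (e.symm k)
    simp [h1, P, h2]
  have hline : ContinuousAt (fun k : K ↦ t₀ + ι k) 0 := by fun_prop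
  have hline' : Filter.Tendsto (fun k : K ↦ t₀ + ι k) (𝓝 0) (𝓝 t₀) := by
    simpa using hline.tendsto
  have hcont : ContinuousAt (fun t ↦ (P ∘L fderiv ℝ φ t) ∘L ι) t₀ :=
    (continuousAt_const.clm_comp
      (hφ.fderiv_right (m := 0) (by simp)).continuousAt).clm_comp continuousAt_const
  have hunit : ∀ᶠ t in 𝓝 t₀, IsUnit ((P ∘L fderiv ℝ φ t) ∘L ι) := by
    refine hcont.eventually (Units.isOpen.mem_nhds ?_)
    simp only [← hA, hPAι]
    exact isUnit_one
  have hdiff : ∀ᶠ t in 𝓝 t₀, DifferentiableAt ℝ φ t :=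
    (hφ.eventually (by simp)).mono fun t ht ↦ ht.differentiableAt (by simp)
  refine ⟨_, ι, P, ?_⟩
  filter_upwards [hline'.eventually hunit, hline'.eventually hdiff, hline'.eventually hmax]
    with k hk1 hk2 hk3
  have hfd : fderiv ℝ (fun k ↦ φ (t₀ + ι k)) k = fderiv ℝ φ (t₀ + ι k) ∘L ι :=
    (HasFDerivAt.comp (g := φ) (f := fun k ↦ t₀ + ι k) k hk2.hasFDerivAt
      (ι.hasFDerivAt.const_add t₀)).fderiv
  rw [hfd]
  refine ⟨hk1, ?_⟩
  have hinj : Function.Injective (fderiv ℝ φ (t₀ + ι k) ∘L ι) := by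
    have := (ContinuousLinearMap.isUnit_iff_bijective.1 hk1).injective
    exact Function.Injective.of_comp (f := P) this
  have hle : LinearMap.range (fderiv ℝ φ (t₀ + ι k) ∘L ι : K →ₗ[ℝ] F) ≤
      LinearMap.range (fderiv ℝ φ (t₀ + ι k) : E →ₗ[ℝ] F) := by
    rintro _ ⟨l, rfl⟩
    exact ⟨ι l, rfl⟩
  have hfin : Module.finrank ℝ (LinearMap.range (fderiv ℝ φ (t₀ + ι k) ∘L ι : K →ₗ[ℝ] F)) =
      Module.finrank ℝ S := (LinearMap.finrank_range_of_inj hinj).trans (by simp [K])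
  -- Restricting to the complement already gives the maximal rank, so it loses nothing of the range.
  have heq := Submodule.eq_of_le_of_finrank_le hle (hk3.trans hfin.ge)
  exact congrArg (fun S : Submodule ℝ F ↦ (S : Set F)) heq

end Tangency

/-! ### The generated Lie algebra in coordinates. -/

section LieHull

variable {d : ℕ} {M : Type*} [TopologicalSpace M] [ChartedSpace (EuclideanSpace ℝ (Fin d)) M]
  [IsManifold (𝓡 d) ω M] {Y : Fin 3 → VectorFieldOn d M}

/-- Vector fields in the Lie algebra generated by analytic vector fields are smooth, and have every
property that passes from the generators to linear combinations and brackets. -/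
lemma lieHull_induction (hY : ∀ i, IsAnalyticVectorField (Y i)) {p : VectorFieldOn d M → Prop}
    (hgen : ∀ i, p (Y i)) (hzero : p 0) (hadd : ∀ V W, p V → p W → p (V + W))
    (hsmul : ∀ (c : ℝ) V, p V → p (c • V))
    (hbracket : ∀ V W : VectorFieldOn d M,
      ContMDiff (𝓡 d) (𝓡 d).tangent ∞ (fun x : M ↦ (⟨x, V x⟩ : TangentBundle (𝓡 d) M)) →
      ContMDiff (𝓡 d) (𝓡 d).tangent ∞ (fun x : M ↦ (⟨x, W x⟩ : TangentBundle (𝓡 d) M)) →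
      p V → p W → p (VectorField.mlieBracket (𝓡 d) V W))
    {V : VectorFieldOn d M} (hV : V ∈ lieHull Y) :
    ContMDiff (𝓡 d) (𝓡 d).tangent ∞ (fun x : M ↦ (⟨x, V x⟩ : TangentBundle (𝓡 d) M)) ∧ p V := by
  let S : Submodule ℝ (VectorFieldOn d M) :=
    { carrier := {V | ContMDiff (𝓡 d) (𝓡 d).tangent ∞
        (fun x : M ↦ (⟨x, V x⟩ : TangentBundle (𝓡 d) M)) ∧ p V}
      add_mem' := fun {V W} hV hW ↦ ⟨hV.1.add_section hW.1, hadd V W hV.2 hW.2⟩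
      zero_mem' := ⟨Bundle.contMDiff_zeroSection ℝ (TangentSpace (𝓡 d) (M := M)), hzero⟩
      smul_mem' := fun c V hV ↦ ⟨hV.1.const_smul_section, hsmul c V hV.2⟩ }
  suffices h : lieHull Y ≤ S from h hV
  refine sInf_le ⟨fun i ↦ ⟨ContMDiff.of_le (hY i) le_top, hgen i⟩, fun V hV W hW ↦
    ⟨fun x ↦ ?_, hbracket V W hV.1 hW.1 hV.2 hW.2⟩⟩
  have : IsManifold (𝓡 d) ((⊤ : ℕ∞) + 1) M := IsManifold.of_le (n := ω) le_top
  exact ContMDiffAt.mlieBracket_vectorField (n := ⊤) (m := ⊤) (hV.1 x) (hW.1 x) (by simp)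

lemma mfderiv_extChartAt_eq_chartField {x₀ : M} {y : EuclideanSpace ℝ (Fin d)}
    (hy : y ∈ (extChartAt (𝓡 d) x₀).target) (V : VectorFieldOn d M) :
    mfderiv (𝓡 d) 𝓘(ℝ, EuclideanSpace ℝ (Fin d)) (extChartAt (𝓡 d) x₀)
      ((extChartAt (𝓡 d) x₀).symm y) (V ((extChartAt (𝓡 d) x₀).symm y)) = chartField x₀ V y := by
  rw [← mfderiv_extChartAt_symm_chartField hy V]
  have h := mfderiv_extChartAt_comp_mfderivWithin_extChartAt_symm (I := 𝓡 d) hy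
  rw [ModelWithCorners.range_eq_univ, mfderivWithin_univ] at h
  exact DFunLike.congr_fun h (chartField x₀ V y)

lemma IsCompleteVectorField.hasDerivAt_extChartAt_vectorFlow {V : VectorFieldOn d M}
    (hc : IsCompleteVectorField V) {x₀ x : M} (hx : x ∈ (extChartAt (𝓡 d) x₀).source) :
    HasDerivAt (fun s ↦ extChartAt (𝓡 d) x₀ (vectorFlow V s x))
      (chartField x₀ V (extChartAt (𝓡 d) x₀ x)) 0 := by
  have hy := (extChartAt (𝓡 d) x₀).map_source hx
  have h1 : HasMFDerivAt 𝓘(ℝ, ℝ) (𝓡 d) (fun s ↦ vectorFlow V s x) 0 _ :=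
    hc.isMIntegralCurve_vectorFlow x 0
  have h2 := (mdifferentiableAt_extChartAt (I := 𝓡 d)
    (by rwa [extChartAt_source] at hx)).hasMFDerivAt
  rw [← hc.vectorFlow_zero x] at h2
  obtain ⟨L, hL, h3⟩ : ∃ L : ℝ →L[ℝ] EuclideanSpace ℝ (Fin d),
      L 1 = mfderiv (𝓡 d) 𝓘(ℝ, EuclideanSpace ℝ (Fin d)) (extChartAt (𝓡 d) x₀) (vectorFlow V 0 x)
        ((1 : ℝ) • V (vectorFlow V 0 x)) ∧
      HasFDerivAt (fun s ↦ extChartAt (𝓡 d) x₀ (vectorFlow V s x)) L 0 :=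
    ⟨_, rfl, (HasMFDerivAt.comp (0 : ℝ) h2 h1).hasFDerivAt⟩
  have h4 : ∀ z, z = x → mfderiv (𝓡 d) 𝓘(ℝ, EuclideanSpace ℝ (Fin d)) (extChartAt (𝓡 d) x₀) z
      ((1 : ℝ) • V z) = chartField x₀ V (extChartAt (𝓡 d) x₀ x) := by
    rintro _ rfl
    have h5 := mfderiv_extChartAt_eq_chartField hy V
    rwa [(extChartAt (𝓡 d) x₀).left_inv hx, ← one_smul ℝ (V _)] at h5
  exact h3.hasDerivAt.congr_deriv (hL.trans (h4 _ (hc.vectorFlow_zero x)))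

/-- Spanning is an open condition: finitely many fields of the Lie algebra form a basis at `x₀`, and
their determinant is continuous. -/
lemma eventually_forall_exists_chartField_eq (hY : ∀ i, IsAnalyticVectorField (Y i)) {x₀ : M}
    (hLie : lieHullAt Y x₀ = ⊤) :
    ∀ᶠ y in 𝓝 (extChartAt (𝓡 d) x₀ x₀), ∀ w, ∃ V ∈ lieHull Y, chartField x₀ V y = w := by
  have hx := mem_extChartAt_target (I := 𝓡 d) x₀
  have h1 : ∀ w, ∃ V ∈ lieHull Y, chartField x₀ V (extChartAt (𝓡 d) x₀ x₀) = w := by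
    intro w
    have h2 : mfderiv 𝓘(ℝ, EuclideanSpace ℝ (Fin d)) (𝓡 d) (extChartAt (𝓡 d) x₀).symm
        (extChartAt (𝓡 d) x₀ x₀) w ∈ lieHullAt Y ((extChartAt (𝓡 d) x₀).symm
          (extChartAt (𝓡 d) x₀ x₀)) := by
      rw [extChartAt_to_inv, hLie]
      trivial
    obtain ⟨V, hV, hVw⟩ := h2
    refine ⟨V, hV, ?_⟩
    refine (isInvertible_mfderiv_extChartAt_symm hx).injective ?_
    rw [mfderiv_extChartAt_symm_chartField hx]
    exact hVw
  choose V hV hVw using fun j : Fin d ↦ h1 (EuclideanSpace.single j 1)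
  let A : EuclideanSpace ℝ (Fin d) → Matrix (Fin d) (Fin d) ℝ :=
    fun y ↦ Matrix.of fun i j ↦ chartField x₀ (V j) y i
  have hA1 : A (extChartAt (𝓡 d) x₀ x₀) = 1 := by
    ext i j
    simp only [A, Matrix.of_apply, hVw]
    simp [Matrix.one_apply]
  have hAc : ContinuousAt (fun y ↦ (A y).det) (extChartAt (𝓡 d) x₀ x₀) := by
    have h2 : ContinuousAt A (extChartAt (𝓡 d) x₀ x₀) := by
      refine continuousAt_pi.2 fun i ↦ continuousAt_pi.2 fun j ↦ ?_
      have h3 := (contDiffAt_chartField hx ((lieHull_induction hY (p := fun _ ↦ True)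
        (by simp) trivial (by simp) (by simp) (by simp) (hV j)).1 _)).continuousAt
      exact (EuclideanSpace.proj i : EuclideanSpace ℝ (Fin d) →L[ℝ] ℝ).continuous.continuousAt.comp
        h3
    exact (continuous_id.matrix_det.continuousAt).comp h2
  have h4 : (A (extChartAt (𝓡 d) x₀ x₀)).det ≠ 0 := by
    rw [hA1]
    simp
  filter_upwards [hAc.eventually_ne h4] with y hy w
  have hu : IsUnit (A y).det := isUnit_iff_ne_zero.2 hy
  refine ⟨∑ j, ((A y)⁻¹.mulVec w) j • V j,
    Submodule.sum_mem _ fun j _ ↦ Submodule.smul_mem _ _ (hV j), ?_⟩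
  have hsum : ∀ (s : Finset (Fin d)) (c : Fin d → ℝ),
      chartField x₀ (∑ j ∈ s, c j • V j) y = ∑ j ∈ s, c j • chartField x₀ (V j) y := by
    intro s c
    induction s using Finset.induction_on with
    | empty => simp [chartField_zero]
    | insert a s ha ih =>
      rw [Finset.sum_insert ha, Finset.sum_insert ha, chartField_add, chartField_smul, Pi.add_apply,
        ih, Pi.smul_apply]
  rw [hsum]
  ext i
  have h2 : ((A y).mulVec ((A y)⁻¹.mulVec w)) i = w i := by
    rw [Matrix.mulVec_mulVec, Matrix.mul_nonsing_inv _ hu, Matrix.one_mulVec]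
  rw [← h2, Matrix.mulVec, dotProduct]
  simp [A, mul_comm]

/-- If the generators are tangent to an immersed submanifold, then so is every vector field in the
Lie algebra that they generate. -/
lemma eventually_chartField_mem_range_fderiv (hY : ∀ i, IsAnalyticVectorField (Y i)) {x₀ : M}
    {K : Type*} [NormedAddCommGroup K] [NormedSpace ℝ K] [CompleteSpace K]
    {ψ : K → EuclideanSpace ℝ (Fin d)} {P : EuclideanSpace ℝ (Fin d) →L[ℝ] K} {k : K}
    (hψ : ∀ᶠ l in 𝓝 k, ContDiffAt ℝ 2 ψ l) (hP : ∀ᶠ l in 𝓝 k, IsUnit (P ∘L fderiv ℝ ψ l))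
    (htarget : ∀ᶠ l in 𝓝 k, ψ l ∈ (extChartAt (𝓡 d) x₀).target)
    (hgen : ∀ i, ∀ᶠ l in 𝓝 k, chartField x₀ (Y i) (ψ l) ∈ Set.range (fderiv ℝ ψ l))
    {V : VectorFieldOn d M} (hV : V ∈ lieHull Y) :
    ∀ᶠ l in 𝓝 k, chartField x₀ V (ψ l) ∈ Set.range (fderiv ℝ ψ l) := by
  refine (lieHull_induction hY
    (p := fun V ↦ ∀ᶠ l in 𝓝 k, chartField x₀ V (ψ l) ∈ Set.range (fderiv ℝ ψ l))
    hgen ?_ ?_ ?_ ?_ hV).2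
  · refine Filter.Eventually.of_forall fun l ↦ ⟨0, ?_⟩
    simp [chartField_zero]
  · intro V W hV hW
    filter_upwards [hV, hW] with l ⟨v, hv⟩ ⟨w, hw⟩
    exact ⟨v + w, by rw [map_add, hv, hw, chartField_add, Pi.add_apply]⟩
  · intro c V hV
    filter_upwards [hV] with l ⟨v, hv⟩
    exact ⟨c • v, by rw [map_smul, hv, chartField_smul, Pi.smul_apply]⟩
  · intro V W hVs hWs hV hW
    filter_upwards [hψ, hP, htarget, hV.eventually_nhds, hW.eventually_nhds] with l h1 h2 h3 h4 h5
    have hne : (∞ : WithTop ℕ∞) ≠ 0 := by simp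
    rw [chartField_mlieBracket h3 ((hVs _).mdifferentiableAt hne) ((hWs _).mdifferentiableAt hne)]
    exact lieBracket_mem_range_fderiv h1 h2
      ((contDiffAt_chartField h3 (hVs _)).differentiableAt hne)
      ((contDiffAt_chartField h3 (hWs _)).differentiableAt hne) h4 h5

end LieHull

/-! ### The splitting scheme as an analytic family indexed by its times. -/

section SplittingFamily

variable {d : ℕ} {M : Type*} [TopologicalSpace M] [ChartedSpace (EuclideanSpace ℝ (Fin d)) M]
  (Y : Fin 3 → VectorFieldOn d M)

/-- One step of the splitting scheme, as a function of the three times and the starting point. -/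
noncomputable def splittingStep (p : (Fin 3 → ℝ) × M) : M :=
  vectorFlow (Y 2) (p.1 2) (vectorFlow (Y 1) (p.1 1) (vectorFlow (Y 0) (p.1 0) p.2))

/-- `m` steps of the splitting scheme, as a function of the times and the starting point. -/
noncomputable def splittingFamily : (m : ℕ) → (Fin m → Fin 3 → ℝ) × M → M
  | 0, p => p.2
  | m + 1, p => splittingStep Y (p.1 (Fin.last m), splittingFamily m (Fin.init p.1, p.2))

/-- Appending an entry to a tuple, as a continuous linear map. -/
noncomputable def snocCLM (T : Type*) [AddCommGroup T] [Module ℝ T] [TopologicalSpace T] (m : ℕ) :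
    (Fin m → T) × T →L[ℝ] (Fin (m + 1) → T) :=
  ContinuousLinearMap.pi (Fin.lastCases (.snd ℝ _ _) fun i ↦ .proj i ∘L .fst ℝ _ _)

variable {Y}

lemma snocCLM_last {T : Type*} [AddCommGroup T] [Module ℝ T] [TopologicalSpace T] {m : ℕ}
    (p : (Fin m → T) × T) : snocCLM T m p (Fin.last m) = p.2 := by
  simp [snocCLM]

lemma init_snocCLM {T : Type*} [AddCommGroup T] [Module ℝ T] [TopologicalSpace T] {m : ℕ}
    (p : (Fin m → T) × T) : Fin.init (snocCLM T m p) = p.1 := by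
  ext i
  simp [snocCLM, Fin.init]

lemma splittingFamily_snocCLM {m : ℕ} (t : Fin m → Fin 3 → ℝ) (s : Fin 3 → ℝ) (x : M) :
    splittingFamily Y (m + 1) (snocCLM _ m (t, s), x) =
      splittingStep Y (s, splittingFamily Y m (t, x)) := by
  simp only [splittingFamily, snocCLM_last, init_snocCLM]

lemma splittingStep_single (hc : ∀ i, IsCompleteVectorField (Y i)) (i : Fin 3) (s : ℝ) (x : M) :
    splittingStep Y (Pi.single i s, x) = vectorFlow (Y i) s x := by
  fin_cases i <;> simp [splittingStep, (hc _).vectorFlow_zero]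

lemma splittingStep_zero (hc : ∀ i, IsCompleteVectorField (Y i)) (x : M) :
    splittingStep Y (0, x) = x := by
  simp [splittingStep, (hc _).vectorFlow_zero]

variable [IsManifold (𝓡 d) ω M] [T2Space M]

lemma contMDiff_splittingStep (hc : ∀ i, IsCompleteVectorField (Y i))
    (hY : ∀ i, IsAnalyticVectorField (Y i)) :
    ContMDiff (𝓘(ℝ, Fin 3 → ℝ).prod (𝓡 d)) (𝓡 d) ω (splittingStep Y) := by
  have hproj : ∀ i : Fin 3, ContMDiff (𝓘(ℝ, Fin 3 → ℝ).prod (𝓡 d)) 𝓘(ℝ, ℝ) ω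
      (fun p : (Fin 3 → ℝ) × M ↦ p.1 i) := fun i ↦
    (ContinuousLinearMap.contMDiff (.proj i : (Fin 3 → ℝ) →L[ℝ] ℝ)).comp contMDiff_fst
  have hflow := fun i ↦ (hc i).contMDiff_vectorFlow (hY i)
  exact (hflow 2).comp ((hproj 2).prodMk ((hflow 1).comp ((hproj 1).prodMk
    ((hflow 0).comp ((hproj 0).prodMk contMDiff_snd)))))

lemma contMDiff_splittingFamily (hc : ∀ i, IsCompleteVectorField (Y i))
    (hY : ∀ i, IsAnalyticVectorField (Y i)) (m : ℕ) :
    ContMDiff (𝓘(ℝ, Fin m → Fin 3 → ℝ).prod (𝓡 d)) (𝓡 d) ω (splittingFamily Y m) := by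
  induction m with
  | zero => exact contMDiff_snd
  | succ m ih =>
    have h1 := ContinuousLinearMap.contMDiff (n := ω)
      (.proj (Fin.last m) : (Fin (m + 1) → Fin 3 → ℝ) →L[ℝ] (Fin 3 → ℝ))
    have h2 := ContinuousLinearMap.contMDiff (n := ω)
      (.pi fun i : Fin m ↦ .proj i.castSucc : (Fin (m + 1) → Fin 3 → ℝ) →L[ℝ] (Fin m → Fin 3 → ℝ))
    exact (contMDiff_splittingStep hc hY).comp ((h1.comp contMDiff_fst).prodMk
      (ih.comp ((h2.comp contMDiff_fst).prodMk contMDiff_snd)))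

end SplittingFamily

/-! ### A submersion from the bracket condition. -/

section Submersion

variable {d : ℕ} {M : Type*} [TopologicalSpace M] [ChartedSpace (EuclideanSpace ℝ (Fin d)) M]
  [IsManifold (𝓡 d) ω M] [T2Space M] {Y : Fin 3 → VectorFieldOn d M}

lemma contMDiff_splittingFamily_left (hc : ∀ i, IsCompleteVectorField (Y i))
    (hY : ∀ i, IsAnalyticVectorField (Y i)) (m : ℕ) (x : M) :
    ContMDiff 𝓘(ℝ, Fin m → Fin 3 → ℝ) (𝓡 d) ω (fun t ↦ splittingFamily Y m (t, x)) :=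
  (contMDiff_splittingFamily hc hY m).comp (contMDiff_id.prodMk contMDiff_const)

lemma contDiffAt_extChartAt_splittingFamily (hc : ∀ i, IsCompleteVectorField (Y i))
    (hY : ∀ i, IsAnalyticVectorField (Y i)) {m : ℕ} {x x₀ : M} {t : Fin m → Fin 3 → ℝ}
    (ht : splittingFamily Y m (t, x) ∈ (extChartAt (𝓡 d) x₀).source) :
    ContDiffAt ℝ ω (fun t ↦ extChartAt (𝓡 d) x₀ (splittingFamily Y m (t, x))) t :=
  contMDiffAt_iff_contDiffAt.1 <| (contMDiffAt_extChartAt' (by rwa [extChartAt_source] at ht)).comp t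
    (contMDiff_splittingFamily_left hc hY m x t)

/-- Adding one step with zero times enlarges the range of the derivative, which then also contains
the generating vector fields. -/
lemma range_fderiv_splittingFamily_succ (hc : ∀ i, IsCompleteVectorField (Y i))
    (hY : ∀ i, IsAnalyticVectorField (Y i)) {m : ℕ} {x x₀ : M} {t : Fin m → Fin 3 → ℝ}
    (ht : splittingFamily Y m (t, x) ∈ (extChartAt (𝓡 d) x₀).source) :
    Set.range (fderiv ℝ (fun t ↦ extChartAt (𝓡 d) x₀ (splittingFamily Y m (t, x))) t) ⊆
      Set.range (fderiv ℝ (fun t ↦ extChartAt (𝓡 d) x₀ (splittingFamily Y (m + 1) (t, x)))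
        (snocCLM _ m (t, 0))) ∧
    ∀ i, chartField x₀ (Y i) (extChartAt (𝓡 d) x₀ (splittingFamily Y m (t, x))) ∈
      Set.range (fderiv ℝ (fun t ↦ extChartAt (𝓡 d) x₀ (splittingFamily Y (m + 1) (t, x)))
        (snocCLM _ m (t, 0))) := by
  set D := fderiv ℝ (fun t ↦ extChartAt (𝓡 d) x₀ (splittingFamily Y (m + 1) (t, x)))
    (snocCLM _ m (t, 0)) with hDdef
  have hD : HasFDerivAt (fun t ↦ extChartAt (𝓡 d) x₀ (splittingFamily Y (m + 1) (t, x))) D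
      (snocCLM _ m (t, 0)) := by
    refine (ContDiffAt.differentiableAt (n := ω)
      (contDiffAt_extChartAt_splittingFamily hc hY ?_) (by simp)).hasFDerivAt
    rwa [splittingFamily_snocCLM, splittingStep_zero hc]
  constructor
  · have h1 : HasFDerivAt (fun t : Fin m → Fin 3 → ℝ ↦ snocCLM (Fin 3 → ℝ) m (t, 0))
        (snocCLM _ m ∘L .inl ℝ _ _) t :=
      (snocCLM (Fin 3 → ℝ) m ∘L .inl ℝ _ _).hasFDerivAt
    have h2 := (HasFDerivAt.comp t hD h1).congr_of_eventuallyEq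
      (f₁ := fun t ↦ extChartAt (𝓡 d) x₀ (splittingFamily Y m (t, x)))
      (Filter.Eventually.of_forall fun t ↦ by
        simp [splittingFamily_snocCLM, splittingStep_zero hc])
    rw [h2.fderiv]
    rintro _ ⟨v, rfl⟩
    exact ⟨_, rfl⟩
  · intro i
    let L : ℝ →L[ℝ] (Fin (m + 1) → Fin 3 → ℝ) :=
      snocCLM _ m ∘L .inr ℝ _ _ ∘L .single ℝ (fun _ : Fin 3 ↦ ℝ) i
    have h1 : HasFDerivAt (fun s : ℝ ↦ snocCLM (Fin 3 → ℝ) m (t, 0) + L s) L 0 :=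
      L.hasFDerivAt.const_add _
    have hL : ∀ s, snocCLM (Fin 3 → ℝ) m (t, 0) + L s = snocCLM (Fin 3 → ℝ) m (t, Pi.single i s) := by
      intro s
      simp [L, ← map_add]
    have h2 : HasFDerivAt
        (fun s ↦ extChartAt (𝓡 d) x₀ (vectorFlow (Y i) s (splittingFamily Y m (t, x))))
        (D ∘L L) 0 := by
      have h3 : HasFDerivAt (fun t ↦ extChartAt (𝓡 d) x₀ (splittingFamily Y (m + 1) (t, x))) D
        (snocCLM _ m (t, 0) + L 0) := by simpa using hD
      refine (HasFDerivAt.comp (0 : ℝ) h3 h1).congr_of_eventuallyEq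
        (Filter.Eventually.of_forall fun s ↦ ?_)
      simp only [Function.comp_apply, hL, splittingFamily_snocCLM, splittingStep_single hc]
    have h4 := h2.hasDerivAt.unique ((hc i).hasDerivAt_extChartAt_vectorFlow ht)
    exact ⟨_, h4⟩

/-- If the Lie algebra spans the tangent space at `x₀`, then some number of steps of the splitting
scheme started at `x₀` is a submersion in the times. -/
theorem exists_surjective_mfderiv_splittingFamily (hc : ∀ i, IsCompleteVectorField (Y i))
    (hY : ∀ i, IsAnalyticVectorField (Y i)) {x₀ : M} (hLie : lieHullAt Y x₀ = ⊤) :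
    ∃ m, 0 < m ∧ ∃ t, Function.Surjective (mfderiv 𝓘(ℝ, Fin m → Fin 3 → ℝ) (𝓡 d)
      (fun t ↦ splittingFamily Y m (t, x₀)) t) := by
  set e := extChartAt (𝓡 d) x₀ with he
  obtain ⟨O, hO, hOo, hxO⟩ := mem_nhds_iff.1 (eventually_forall_exists_chartField_eq hY hLie)
  let φ : (m : ℕ) → (Fin m → Fin 3 → ℝ) → EuclideanSpace ℝ (Fin d) :=
    fun m t ↦ e (splittingFamily Y m (t, x₀))
  let good : (m : ℕ) → (Fin m → Fin 3 → ℝ) → Prop := fun m t ↦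
    splittingFamily Y m (t, x₀) ∈ e.source ∧ φ m t ∈ O
  let rg : (m : ℕ) → (Fin m → Fin 3 → ℝ) → Submodule ℝ (EuclideanSpace ℝ (Fin d)) := fun m t ↦
    LinearMap.range (fderiv ℝ (φ m) t : (Fin m → Fin 3 → ℝ) →ₗ[ℝ] EuclideanSpace ℝ (Fin d))
  let rank : (m : ℕ) → (Fin m → Fin 3 → ℝ) → ℕ := fun m t ↦ Module.finrank ℝ (rg m t)
  have hcont : ∀ {m t}, good m t → ContDiffAt ℝ ω (φ m) t := fun h ↦
    contDiffAt_extChartAt_splittingFamily hc hY h.1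
  have hgood_succ : ∀ {m t}, good m t → good (m + 1) (snocCLM _ m (t, 0)) := by
    intro m t h
    simpa only [good, φ, splittingFamily_snocCLM, splittingStep_zero hc] using h
  have hgood : ∀ {m t}, good m t → ∀ᶠ t' in 𝓝 t, good m t' := by
    intro m t h
    exact ((contMDiff_splittingFamily_left hc hY m x₀).continuous.continuousAt.eventually
      ((isOpen_extChartAt_source x₀).mem_nhds h.1)).and
      ((hcont h).continuousAt.eventually (hOo.mem_nhds h.2))
  -- The rank is maximized over all numbers of steps at once, so that it can be compared with the
  -- rank after one more step.
  let R : Set ℕ := {r | ∃ m t, good m t ∧ rank m t = r}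
  have hRne : R.Nonempty := ⟨_, 0, 0, ⟨mem_extChartAt_source x₀, hxO⟩, rfl⟩
  have hRb : BddAbove R := ⟨d, by
    rintro _ ⟨m, t, -, rfl⟩
    simpa using Submodule.finrank_le (rg m t)⟩
  obtain ⟨m, t, hmt, hr⟩ := Nat.sSup_mem hRne hRb
  have hmax : ∀ {m' t'}, good m' t' → rank m' t' ≤ rank m t := fun h ↦ by
    rw [hr]
    exact le_csSup hRb ⟨_, _, h, rfl⟩
  have hgen : ∀ {t'}, good m t' → rank m t' = rank m t → ∀ i,
      chartField x₀ (Y i) (φ m t') ∈ Set.range (fderiv ℝ (φ m) t') := by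
    intro t' h h' i
    obtain ⟨h1, h2⟩ := range_fderiv_splittingFamily_succ hc hY h.1
    have h3 : rg m t' ≤ rg (m + 1) (snocCLM _ m (t', 0)) := h1
    have h4 := Submodule.eq_of_le_of_finrank_le h3 ((hmax (hgood_succ h)).trans h'.ge)
    have h5 : chartField x₀ (Y i) (φ m t') ∈ rg (m + 1) (snocCLM _ m (t', 0)) := h2 i
    rw [← h4] at h5
    exact h5
  obtain ⟨r, ι, Q, himm⟩ := exists_immersion_of_maximal_rank (hcont hmt)
    ((hgood hmt).mono fun t' h ↦ hmax h)
  have hline : Filter.Tendsto (fun k ↦ t + ι k) (𝓝 0) (𝓝 t) := by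
    have h1 : ContinuousAt (fun k ↦ t + ι k) 0 := by fun_prop
    simpa using h1.tendsto
  have hrank : ∀ᶠ k in 𝓝 0, rank m (t + ι k) = r := by
    filter_upwards [himm] with k ⟨h1, h2⟩
    have h3 : LinearMap.range (fderiv ℝ (fun k ↦ φ m (t + ι k)) k :
        EuclideanSpace ℝ (Fin r) →ₗ[ℝ] EuclideanSpace ℝ (Fin d)) = rg m (t + ι k) :=
      SetLike.coe_injective h2
    have h4 : Function.Injective (fderiv ℝ (fun k ↦ φ m (t + ι k)) k) :=
      Function.Injective.of_comp (f := Q) (ContinuousLinearMap.isUnit_iff_bijective.1 h1).injective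
    change Module.finrank ℝ (rg m (t + ι k)) = r
    rw [← h3, LinearMap.finrank_range_of_inj h4]
    simp
  have hrank0 : rank m t = r := by simpa using hrank.self_of_nhds
  have hgoodk := hline.eventually (hgood hmt)
  have hfield : ∀ V ∈ lieHull Y, chartField x₀ V (φ m t) ∈ Set.range (fderiv ℝ (φ m) t) := by
    intro V hV
    have h1 := eventually_chartField_mem_range_fderiv hY (x₀ := x₀) (k := 0) (P := Q)
      (ψ := fun k ↦ φ m (t + ι k))
      (hgoodk.mono fun k hk ↦ by
        have h2 : ContDiffAt ℝ 2 (φ m) (t + ι k) := (hcont hk).of_le le_top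
        exact ContDiffAt.comp (g := φ m) (f := fun k ↦ t + ι k) k h2 (by fun_prop))
      (himm.mono fun k hk ↦ hk.1) (hgoodk.mono fun k hk ↦ e.map_source hk.1)
      (fun i ↦ by
        filter_upwards [himm, hrank, hgoodk] with k h1 h2 h3
        rw [h1.2]
        exact hgen h3 (h2.trans hrank0.symm) i) hV
    have h2 := h1.self_of_nhds
    rw [himm.self_of_nhds.2] at h2
    simpa using h2
  have hsurj : Function.Surjective (fderiv ℝ (φ m) t) := by
    intro w
    obtain ⟨V, hV, rfl⟩ := hO hmt.2 w
    exact hfield V hV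
  -- The maximum may occur at `m = 0` when `d = 0`; an extra step with zero times makes the number
  -- of steps positive.
  refine ⟨m + 1, m.succ_pos, snocCLM _ m (t, 0), ?_⟩
  have hsource := (hgood_succ hmt).1
  refine (surjective_mfderiv_iff_fderiv_extChartAt (y₀ := x₀)
    (((contMDiff_splittingFamily_left hc hY (m + 1) x₀).mdifferentiable (by simp)) _) hsource).2 ?_
  rw [← Set.range_eq_univ] at hsurj ⊢
  exact Set.univ_subset_iff.1 (hsurj.ge.trans (range_fderiv_splittingFamily_succ hc hY hmt.1).1)

end Submersion

/-! ### Bounded density of the law of the times. -/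

section Bounds

/-- A power of a measure with bounded density has bounded density. -/
lemma MeasureTheory.Measure.exists_pi_le_smul {α : Type*} [MeasurableSpace α] {μ ν : Measure α}
    [SigmaFinite μ] [SigmaFinite ν] {c : NNReal} (h : μ ≤ (c : ENNReal) • ν) (n : ℕ) :
    ∃ C : NNReal, Measure.pi (fun _ : Fin n ↦ μ) ≤ (C : ENNReal) • Measure.pi fun _ : Fin n ↦ ν := by
  induction n with
  | zero => exact ⟨1, by simp [Measure.pi_of_empty _ (fun i : Fin 0 ↦ i.elim0)]⟩
  | succ n ih =>
    obtain ⟨C, hC⟩ := ih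
    refine ⟨c * C, ?_⟩
    rw [← ((measurePreserving_piFinSuccAbove (fun _ : Fin (n + 1) ↦ μ) 0).symm _).map_eq,
      ← ((measurePreserving_piFinSuccAbove (fun _ : Fin (n + 1) ↦ ν) 0).symm _).map_eq,
      ← Measure.map_smul]
    refine Measure.map_mono ?_ (MeasurableEquiv.measurable _)
    refine (Measure.prod_mono h hC).trans_eq ?_
    rw [Measure.prod_smul_left, Measure.prod_smul_right, smul_smul, ENNReal.coe_mul]

lemma ProbabilityTheory.expMeasure_le_smul_volume {r : ℝ} (hr : 0 < r) :
    expMeasure r ≤ (r.toNNReal : ENNReal) • volume := by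
  have h1 : expMeasure r = volume.withDensity (exponentialPDF r) := rfl
  rw [h1, ← withDensity_const]
  refine withDensity_mono (Filter.Eventually.of_forall fun x ↦ ?_)
  rw [exponentialPDF_eq]
  refine ENNReal.ofReal_le_ofReal ?_
  split_ifs with hx
  · have h2 : Real.exp (-(r * x)) ≤ 1 := Real.exp_le_one_iff.2 (by nlinarith)
    nlinarith
  · exact hr.le

end Bounds

/-! ### Iterates of the transition operator as integrals over times. -/

section Kernel

variable {d : ℕ} {M : Type*} [TopologicalSpace M] [T2Space M]
  [ChartedSpace (EuclideanSpace ℝ (Fin d)) M] [IsManifold (𝓡 d) ω M] [MeasurableSpace M]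
  [BorelSpace M] {Y : Fin 3 → VectorFieldOn d M}
  {Ω : Type*} [MeasurableSpace Ω] {P : Measure Ω} [IsProbabilityMeasure P] {τ : ℕ → Ω → ℝ}

lemma kernelOperator_splittingKernel (hc : ∀ i, IsCompleteVectorField (Y i))
    (hY : ∀ i, IsAnalyticVectorField (Y i)) {ρ : Measure ℝ} (hτ_indep : iIndepFun τ P)
    (hτ_law : ∀ n, HasLaw (τ n) ρ P) {g : M → ℝ} (hg : Measurable g) (x : M) :
    kernelOperator (splittingKernel P Y τ) g x =
      ∫ s, g (splittingStep Y (s, x)) ∂Measure.pi fun _ : Fin 3 ↦ ρ := by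
  have hτ : AEMeasurable (fun o (i : Fin 3) ↦ τ i o) P :=
    aemeasurable_pi_iff.2 fun i ↦ (hτ_law i).aemeasurable
  have hlaw : P.map (fun o (i : Fin 3) ↦ τ i o) = Measure.pi fun _ ↦ ρ := by
    have h1 := (iIndepFun_iff_map_fun_eq_pi_map fun i : Fin 3 ↦ (hτ_law i).aemeasurable).1
      (hτ_indep.precomp Fin.val_injective)
    rw [h1]
    congr 1
    ext1 i
    exact (hτ_law i).map_eq
  have hstep : Measurable fun s ↦ splittingStep Y (s, x) :=
    ((contMDiff_splittingStep hc hY).continuous.comp (by fun_prop)).measurable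
  have hker : splittingKernel P Y τ x =
      (Measure.pi fun _ : Fin 3 ↦ ρ).map fun s ↦ splittingStep Y (s, x) := by
    rw [← hlaw, AEMeasurable.map_map_of_aemeasurable hstep.aemeasurable hτ]
    rfl
  rw [kernelOperator, hker, integral_map hstep.aemeasurable hg.aestronglyMeasurable]

variable [SecondCountableTopology M]

/-- The iterates of the transition operator are averages over independent times. -/
lemma iterate_kernelOperator_splittingKernel (hc : ∀ i, IsCompleteVectorField (Y i))
    (hY : ∀ i, IsAnalyticVectorField (Y i)) {ρ : Measure ℝ} [IsProbabilityMeasure ρ]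
    (hτ_indep : iIndepFun τ P) (hτ_law : ∀ n, HasLaw (τ n) ρ P) (m : ℕ) {g : M → ℝ}
    (hg : Measurable g) (hb : ∃ C : ℝ, ∀ x, |g x| ≤ C) (x : M) :
    (kernelOperator (splittingKernel P Y τ))^[m] g x =
      ∫ t, g (splittingFamily Y m (t, x)) ∂Measure.pi fun _ : Fin m ↦
        Measure.pi fun _ : Fin 3 ↦ ρ := by
  induction m generalizing g with
  | zero => simp [splittingFamily]
  | succ m ih =>
    set η := Measure.pi fun _ : Fin 3 ↦ ρ
    obtain ⟨C, hC⟩ := hb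
    have hstep : Measurable (splittingStep Y) := (contMDiff_splittingStep hc hY).continuous.measurable
    have hfam : Measurable (splittingFamily Y m) :=
      (contMDiff_splittingFamily hc hY m).continuous.measurable
    have hQ : kernelOperator (splittingKernel P Y τ) g = fun x ↦ ∫ s, g (splittingStep Y (s, x)) ∂η :=
      funext fun x ↦ kernelOperator_splittingKernel hc hY hτ_indep hτ_law hg x
    have hQm : Measurable (kernelOperator (splittingKernel P Y τ) g) := by
      rw [hQ]
      exact ((hg.comp hstep).stronglyMeasurable.integral_prod_left' (μ := η)).measurable
    have hQb : ∀ x, |kernelOperator (splittingKernel P Y τ) g x| ≤ C := fun x ↦ by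
      rw [hQ]
      have h1 : ‖∫ s, g (splittingStep Y (s, x)) ∂η‖ ≤ C * η.real Set.univ :=
        norm_integral_le_of_norm_le_const (Filter.Eventually.of_forall fun s ↦ hC _)
      simpa using h1
    -- The operator applied first to `g` corresponds to the last step of the chain, so the index
    -- split off below is `Fin.last m`.
    rw [Function.iterate_succ_apply, ih hQm ⟨C, hQb⟩, hQ]
    let F : (Fin 3 → ℝ) × (Fin m → Fin 3 → ℝ) → ℝ :=
      fun p ↦ g (splittingStep Y (p.1, splittingFamily Y m (p.2, x)))
    have hF : Integrable F (η.prod (Measure.pi fun _ : Fin m ↦ η)) := by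
      refine Integrable.of_bound (Measurable.aestronglyMeasurable ?_) C
        (Filter.Eventually.of_forall fun p ↦ hC _)
      exact hg.comp (hstep.comp (measurable_fst.prodMk (hfam.comp
        (measurable_snd.prodMk measurable_const))))
    have h1 := (measurePreserving_piFinSuccAbove (fun _ : Fin (m + 1) ↦ η) (Fin.last m)).integral_comp' F
    have h2 := integral_prod_symm F hF
    rw [← h2, ← h1]
    refine integral_congr_ae (Filter.Eventually.of_forall fun t ↦ ?_)
    simp [F, splittingFamily, MeasurableEquiv.piFinSuccAbove, Fin.init_def]

end Kernel

theorem mainTheorem11 {d : ℕ} {M : Type*} [TopologicalSpace M] [T2Space M]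
    [SecondCountableTopology M] [ChartedSpace (EuclideanSpace ℝ (Fin d)) M]
    [IsManifold (𝓡 d) ω M] [MeasurableSpace M] [BorelSpace M]
    (Y : Fin 3 → VectorFieldOn d M)
    (hY_analytic : ∀ i, IsAnalyticVectorField (Y i))
    (hY_complete : ∀ i, IsCompleteVectorField (Y i))
    {h : ℝ} (hh : 0 < h)
    {Ω : Type*} [MeasurableSpace Ω] (P : Measure Ω) [IsProbabilityMeasure P]
    (τ : ℕ → Ω → ℝ) (hτ_indep : iIndepFun τ P)
    (hτ_law : ∀ n, HasLaw (τ n) (expMeasure (1 / h)) P)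
    (x₀ : M) (hLie : lieHullAt Y x₀ = ⊤) :
    ∃ m : ℕ, 0 < m ∧ ∃ U : Set M, IsOpen U ∧ x₀ ∈ U ∧
      StrongFellerOn (kernelOperator (splittingKernel P Y τ))^[m] U := by
  have hr : 0 < 1 / h := by positivity
  have : IsProbabilityMeasure (expMeasure (1 / h)) := isProbabilityMeasure_expMeasure hr
  obtain ⟨m, hm, t, hs⟩ := exists_surjective_mfderiv_splittingFamily hY_complete hY_analytic hLie
  obtain ⟨c, hc⟩ := Measure.exists_pi_le_smul (expMeasure_le_smul_volume hr) 3
  obtain ⟨C, hC⟩ := Measure.exists_pi_le_smul hc m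
  obtain ⟨U, hU, hxU, hcont⟩ := exists_isOpen_continuousOn_integral
    (volume : Measure (Fin m → Fin 3 → ℝ))
    (contMDiff_splittingFamily hY_complete hY_analytic m) hC hs
  refine ⟨m, hm, U, hU, hxU, fun g hg hb ↦ (hcont g hg hb).congr fun x _ ↦ ?_⟩
  exact iterate_kernelOperator_splittingKernel hY_complete hY_analytic hτ_indep hτ_law m hg hb x
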